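/- Let $A$ be a Noetherian commutative ring and let $R=\bigoplus_{k\ge 0}R_k$ be a nonnegatively graded commutative ring with $R_0=A$ that is finitely generated as an $A$-algebra. Let $S=A[x_1,\dots,x_n]$ be graded by $\deg x_i=\delta_i>0$ and $\deg A=0$, let $S\twoheadrightarrow R$ be a graded surjection of $A$-algebras with kernel $I$, so that $R\cong S/I$, and let $\delta=\delta_1+\cdots+\delta_n$. For a graded module $M$, write $M(a)_k=M_{a+k}$ and ${}^*\mathrm{Hom}_A(M,A)=\bigoplus_{\nu\in\mathbb Z}\mathrm{Hom}_A(M_{-\nu},A)$. Suppose that $R$ is finite and flat as an $A$-module. Let $d>0$ be an integer and let $\rho\colon R\to A(-d)$ be a graded $A$-linear map (that is, an $A$-linear map $R\to A$ that vanishes on $R_k$ for all $k\ne d$) such that $R$ satisfies Poincaré duality with respect to $\rho$, that is, the pairing $R\otimes_A R\to A(-d)$, $r_1\otimes r_2\mapsto\rho(r_1r_2)$, is perfect. Then the following hold. (i) $R$ is Artinian Gorenstein over $A$: it is finite and flat over $A$, and for every $\mathfrak p\in\mathrm{Spec}(A)$ with residue field $\kappa(\mathfrak p)$ the fiber $R\otimes_A\kappa(\mathfrak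 p)$ is a Gorenstein ring (a Noetherian ring whose localizations at prime ideals have finite injective dimension over themselves). (ii) All fibers $R\otimes_A\kappa(\mathfrak p)$ have Krull dimension $0$, so the relative canonical module of $R$ over $A$ is $\omega_{R/A}=\mathrm{Ext}^n_S(R,S(-\delta))$, and there are isomorphisms of graded $R$-modules $$\omega_{R/A}=\mathrm{Ext}^n_S(R,S(-\delta))\;\cong\;{}^*\mathrm{Hom}_A(R,A)\;\cong\;R(d).$$ (iii) Let $T=A[y_1,\dots,y_n]$ be the inverse polynomial ring, on which $S$ acts $A$-bilinearly by $x^\alpha\cdot y^\beta=y^{\beta-\alpha}$ if $\beta_i\ge\alpha_i$ for all $i$ and $x^\alpha\cdot y^\beta=0$ otherwise. Put $$G_R=\sum_{\alpha_1\delta_1+\cdots+\alpha_n\delta_n=d}\rho(x_1^{\alpha_1}\cdots x_n^{\alpha_n})\,y_1^{\alpha_1}\cdots y_n^{\alpha_n}\in T.$$ Then $I=\{g\in S\mid g\cdot G_R=0\}$. -/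

import Mathlib

open CategoryTheory

universe u

noncomputable section

namespace RelGor

/-! ### Gorenstein rings and Gorenstein algebras over a base -/

/-- A Noetherian ring is Gorenstein if each of its localizations at a prime ideal has finite
injective dimension as a module over itself. -/
structure IsGorensteinRing (B : Type u) [CommRing B] : Prop where
  noetherian : IsNoetherianRing B
  injDim_ne_top : ∀ (P : Ideal B) [P.IsPrime],
    injectiveDimension
      (ModuleCat.of (Localization.AtPrime P) (Localization.AtPrime P)) ≠ ⊤

/-- `R` is Gorenstein over `A`: it is `A`-flat and all fibres `κ(𝔭) ⊗[A] R` are Gorenstein rings. -/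
structure IsGorensteinOver (A R : Type u) [CommRing A] [CommRing R] [Algebra A R] : Prop where
  flat : Module.Flat A R
  fiber : ∀ p : PrimeSpectrum A, IsGorensteinRing (p.asIdeal.Fiber R)

/-- `R` is Artinian Gorenstein over `A`: it is Gorenstein over `A` and
`Spec R → Spec A` is a finite morphism. -/
structure IsArtinianGorensteinOver (A R : Type u) [CommRing A] [CommRing R] [Algebra A R] :
    Prop extends IsGorensteinOver A R where
  finite : Module.Finite A R

/-! ### `ℤ`-graded modules -/

/-- `𝓜` makes `M` a `ℤ`-graded module over the ring `S` graded by `𝒮`. -/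
structure IsGradedModule {S M : Type*} [CommRing S] [AddCommGroup M] [Module S M]
    (𝒮 : ℤ → AddSubgroup S) (𝓜 : ℤ → AddSubgroup M) : Prop where
  isInternal : DirectSum.IsInternal 𝓜
  smul_mem : ∀ (i j : ℤ) (s : S) (m : M), s ∈ 𝒮 i → m ∈ 𝓜 j → s • m ∈ 𝓜 (i + j)

/-- The grading of the shifted module `M(a)`, with `M(a)_k = M_{a + k}`. -/
def shift {M : Type*} [AddCommGroup M] (𝓜 : ℤ → AddSubgroup M) (a : ℤ) : ℤ → AddSubgroup M :=
  fun k => 𝓜 (a + k)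

/-- A linear equivalence matching the homogeneous elements of degree `k` on both sides, for every
`k`. -/
def IsGradedEquiv {S M N : Type*} [CommRing S] [AddCommGroup M] [Module S M] [AddCommGroup N]
    [Module S N] (𝓜 : ℤ → Set M) (𝓝 : ℤ → Set N) (e : M ≃ₗ[S] N) : Prop :=
  ∀ (k : ℤ) (x : M), x ∈ 𝓜 k ↔ e x ∈ 𝓝 k

/-- The grading of `A[x₁,…,xₙ]` with `deg xᵢ = δᵢ`. -/
def polyGrading {n : ℕ} (A : Type u) [CommRing A] (δ : Fin n → ℕ) :
    ℤ → AddSubgroup (MvPolynomial (Fin n) A) :=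
  fun k => (MvPolynomial.weightedHomogeneousSubmodule A (fun i => (δ i : ℤ)) k).toAddSubgroup

/-! ### The relative graded dual `*Hom_A(M, A)` -/

/-- `Hom_A(M, A)`, as a module over any ring acting `A`-linearly on `M`, by
`(s • φ) m = φ (s • m)`. -/
def RelDual (A M : Type*) [CommRing A] [AddCommGroup M] [Module A M] := M →ₗ[A] A

namespace RelDual

variable {A M B : Type*} [CommRing A] [AddCommGroup M] [Module A M]
  [CommRing B] [Module B M] [SMulCommClass B A M]

instance : AddCommGroup (RelDual A M) := inferInstanceAs (AddCommGroup (M →ₗ[A] A))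

instance : FunLike (RelDual A M) M A := inferInstanceAs (FunLike (M →ₗ[A] A) M A)

instance : Module B (RelDual A M) where
  smul b φ := LinearMap.comp (φ : M →ₗ[A] A) (DistribSMul.toLinearMap A M b)
  one_smul φ := LinearMap.ext fun m => congrArg φ (one_smul B m)
  mul_smul b c φ := LinearMap.ext fun m => congrArg φ (by
    change (b * c) • m = c • b • m
    rw [mul_comm, mul_smul])
  smul_zero b := rfl
  smul_add b φ ψ := rfl
  add_smul b c φ := LinearMap.ext fun m =>
    (congrArg φ (add_smul b c m)).trans (LinearMap.map_add φ (b • m) (c • m))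
  zero_smul φ := LinearMap.ext fun m =>
    (congrArg φ (zero_smul B m)).trans (LinearMap.map_zero φ)

theorem smul_apply (b : B) (φ : RelDual A M) (m : M) : (b • φ) m = φ (b • m) := rfl

end RelDual

/-- The functionals of degree `ν`, that is `Hom_A(M_{-ν}, A)`: those that vanish on `M_k` for all
`k ≠ -ν`. -/
def homogeneousFunctionals (A : Type*) {M : Type*} [CommRing A] [AddCommGroup M] [Module A M]
    (𝓜 : ℤ → AddSubgroup M) (ν : ℤ) : Set (RelDual A M) :=
  {φ | ∀ k : ℤ, k ≠ -ν → ∀ m ∈ 𝓜 k, φ m = 0}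

/-- `*Hom_A(M, A) = ⨁_ν Hom_A(M_{-ν}, A)` for a graded module `M` over a graded ring `B`, as the
`B`-submodule of `Hom_A(M, A)` generated by the homogeneous functionals. (A homogeneous element of
`B` maps a homogeneous functional to a homogeneous functional, so this is the set of the sums of
homogeneous functionals.) -/
def gradedDual (A B : Type*) {M : Type*} [CommRing A] [AddCommGroup M] [Module A M]
    [CommRing B] [Module B M] [SMulCommClass B A M] (𝓜 : ℤ → AddSubgroup M) :
    Submodule B (RelDual A M) :=
  Submodule.span B (⋃ ν : ℤ, homogeneousFunctionals A 𝓜 ν)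

/-- The homogeneous part of degree `ν` of `*Hom_A(M, A)`. -/
def gradedDualGrading (A B : Type*) {M : Type*} [CommRing A] [AddCommGroup M] [Module A M]
    [CommRing B] [Module B M] [SMulCommClass B A M] (𝓜 : ℤ → AddSubgroup M) (ν : ℤ) :
    Set (gradedDual A B 𝓜) :=
  {φ | (φ : RelDual A M) ∈ homogeneousFunctionals A 𝓜 ν}

/-! ### The grading of `Ext` -/

section Ext

variable {S : Type u} [CommRing S]

/-- A graded projective resolution of a graded `S`-module `(M, 𝓜)`: a projective resolution with
graded terms whose differentials and augmentation are homogeneous of degree `0`. -/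
structure GradedProjectiveResolution (𝒮 : ℤ → AddSubgroup S) (M : ModuleCat.{u} S)
    (𝓜 : ℤ → AddSubgroup M) where
  res : ProjectiveResolution M
  grading : ∀ i : ℕ, ℤ → AddSubgroup (res.complex.X i)
  isGraded : ∀ i, IsGradedModule 𝒮 (grading i)
  d_mem : ∀ (i j : ℕ) (k : ℤ) (x : res.complex.X i), x ∈ grading i k →
    (res.complex.d i j).hom x ∈ grading j k
  augmentation_mem : ∀ (k : ℤ) (x : res.complex.X 0), x ∈ grading 0 k →
    (res.π.f 0 ≫
      (HomologicalComplex.singleObjXSelf (ComplexShape.down ℕ) 0 M).hom).hom x ∈ 𝓜 k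

/-- The homogeneous part of degree `ν` of `Extⁱ_S(M, N)` for graded modules `(M, 𝓜)`, `(N, 𝓝)`: the
cohomology classes of those cocycles `Pᵢ → N` that are homogeneous of degree `ν`, where `P` is a
graded projective resolution of `M`. -/
def extGrading (𝒮 : ℤ → AddSubgroup S) {M N : ModuleCat.{u} S} (𝓜 : ℤ → AddSubgroup M)
    (𝓝 : ℤ → AddSubgroup N) (i : ℕ) (ν : ℤ) : Set (Abelian.Ext.{u} M N i) :=
  {x | ∃ (P : GradedProjectiveResolution 𝒮 M 𝓜) (f : P.res.complex.X i ⟶ N)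
      (hf : P.res.complex.d (i + 1) i ≫ f = 0),
      (∀ (k : ℤ) (y : P.res.complex.X i), y ∈ P.grading i k → f.hom y ∈ 𝓝 (k + ν)) ∧
      P.res.extMk f (i + 1) rfl hf = x}

end Ext

/-! ### Poincaré duality -/

/-- `R` satisfies Poincaré duality with respect to the orientation `ρ : R → A(-d)`: `ρ` is
homogeneous of degree `0` as a map to `A(-d)`, i.e. it vanishes on `R_k` for `k ≠ d`, and
`r₁ ⊗ r₂ ↦ ρ (r₁ r₂)` is a perfect pairing. -/
structure SatisfiesPoincareDuality {A R : Type*} [CommRing A] [CommRing R] [Algebra A R]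
    (𝓡 : ℤ → Submodule A R) (d : ℕ) (ρ : R →ₗ[A] A) : Prop where
  graded : ∀ k : ℤ, k ≠ d → ∀ r ∈ 𝓡 k, ρ r = 0
  perfect : ((LinearMap.mul A R).compr₂ ρ).IsPerfPair

/-! ### Inverse polynomials -/

section Contraction

variable {n : ℕ} {A : Type*} [CommRing A]

/-- The action `g · G` of `g ∈ A[x₁,…,xₙ]` on an inverse polynomial `G ∈ A[y₁,…,yₙ]`,
`yᵢ = xᵢ⁻¹`: the `A`-bilinear extension of `x^α · y^β = y^(β - α)` if `α ≤ β`, and `0`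
otherwise. -/
def contract (g G : MvPolynomial (Fin n) A) : MvPolynomial (Fin n) A :=
  ∑ α ∈ g.support, ∑ β ∈ G.support,
    if α ≤ β then MvPolynomial.monomial (β - α) (g.coeff α * G.coeff β) else 0

/-- `G_R = ∑ ρ(x^α) y^α`, the sum over the finitely many `α` with
`α₁ δ₁ + ⋯ + αₙ δₙ = d`. -/
def macaulayDualGenerator {R : Type*} [CommRing R] [Algebra A R]
    [Algebra (MvPolynomial (Fin n) A) R] (δ : Fin n → ℕ) (hδ : ∀ i, 0 < δ i) (d : ℕ)
    (ρ : R →ₗ[A] A) : MvPolynomial (Fin n) A :=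
  ∑ α ∈ (Finsupp.finite_of_nat_weight_eq δ (fun i => (hδ i).ne') d).toFinset,
    MvPolynomial.monomial α
      (ρ (algebraMap (MvPolynomial (Fin n) A) R (MvPolynomial.monomial α 1)))

end Contraction

end RelGor

end

/-! Everything rests on the enveloping algebra `S ⊗[A] R = R[x₁,…,xₙ]`, called `EnvPoly n R` and
written `B` here. With `rᵢ` the image of `xᵢ` in `R`, the multiplication map `B → R` is evaluation
at `r`, and its kernel is generated by `tᵢ = xᵢ - rᵢ`. A translation of the variables turns `t` into
the sequence of variables, so the Koszul complex of `t` is exact in positive degrees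
(`koszul_exact`). As `R` is finite and flat over a Noetherian ring it is projective over `A`, so `B`
is projective over `S`, and the Koszul complex is an `S`-projective resolution of `R` of length `n`
(`koszulResolution`).

The perfect pairing extends to `B`: every `S`-linear `B → S` is `q ↦ trace ρ (p * q)` for a unique
`p` (`exists_traceMul_eq`, `eq_zero_of_traceMul`). The top cochains are therefore a copy of `B`, all
of them are cocycles, and the coboundaries are the ideal generated by `t`; hence `Extⁿ(R, S) ≅ B /
(t) ≅ R` (`extClass_eq_zero_iff`, `extEquiv`). The generator of the top Koszul term has degree `∑
δᵢ`, which the twist of `S` cancels, and the trace has degree `-d`, which yields `R(d)`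
(`mem_extGrading_iff_extEquiv_mem`). The grading of `Ext` may be read off this one resolution,
because comparison maps between graded resolutions can be made homogeneous (`mem_extGrading_iff`).

The other claims use the pairing directly. The map `r ↦ ρ (r ·)` identifies `R(d)` with the graded
dual (`gradedDualEquiv`). The coefficient of `y^γ` in `g · G_R` is `ρ (g x^γ)`, and the `x^γ` span
`R`, so `g` kills `G_R` exactly when its image in `R` is zero
(`contract_macaulayDualGenerator_eq_zero_iff`). On fibres, dual bases survive base change, so each
fibre is a finite algebra over a field with a nondegenerate form; such an algebra and all its
localizations are self-injective (`isGorensteinRing_of_form`). -/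

noncomputable section

namespace RelGor

/-! ### The Koszul complex -/

section Koszul

variable {n : ℕ} {B : Type*} [CommRing B]

/-- The sign `(-1) ^ #{j ∈ J | j < i}`. -/
def koszulSign (i : Fin n) (J : Finset (Fin n)) : ℤ := (-1) ^ (J.filter (· < i)).card

theorem koszulSign_mul_self (i : Fin n) (J : Finset (Fin n)) :
    koszulSign i J * koszulSign i J = 1 := by
  rw [koszulSign, ← mul_pow]; simp

theorem koszulSign_insert (i : Fin n) {j : Fin n} {J : Finset (Fin n)} (hj : j ∉ J) :
    koszulSign i (insert j J) = koszulSign i J * (if j < i then -1 else 1) := by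
  unfold koszulSign
  rw [Finset.filter_insert]
  split_ifs with h
  · rw [Finset.card_insert_of_notMem (by simp [hj]), pow_succ]
  · rw [mul_one]

theorem koszulSign_insert_self (i : Fin n) {J : Finset (Fin n)} (hi : i ∉ J) :
    koszulSign i (insert i J) = koszulSign i J := by
  rw [koszulSign_insert i hi]; simp

/-- Exactly one of `i < j` and `j < i` holds, so exactly one of the two insertions flips a sign. -/
theorem koszulSign_mul_insert {i j : Fin n} {J : Finset (Fin n)} (hi : i ∉ J) (hj : j ∉ J)
    (hij : i ≠ j) :
    koszulSign i J * koszulSign j (insert i J) =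
      -(koszulSign j J * koszulSign i (insert j J)) := by
  rw [koszulSign_insert _ hi, koszulSign_insert _ hj]
  rcases lt_or_gt_of_ne hij with h | h
  · rw [if_pos h, if_neg h.not_gt]; ring
  · rw [if_neg h.not_gt, if_pos h]; ring

/-- The Koszul differential of the sequence `t`, on the functions on all subsets of `Fin n`. -/
def koszulD (t : Fin n → B) : (Finset (Fin n) → B) →ₗ[B] (Finset (Fin n) → B) where
  toFun f J := ∑ j ∈ Jᶜ, (koszulSign j J : B) * (t j * f (insert j J))
  map_add' f g := by
    funext J
    simp only [Pi.add_apply, mul_add, Finset.sum_add_distrib]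
  map_smul' b f := by
    funext J
    simp only [Pi.smul_apply, smul_eq_mul, RingHom.id_apply, Finset.mul_sum]
    exact Finset.sum_congr rfl fun j _ => by ring

theorem koszulD_apply (t : Fin n → B) (f : Finset (Fin n) → B) (J : Finset (Fin n)) :
    koszulD t f J = ∑ j ∈ Jᶜ, (koszulSign j J : B) * (t j * f (insert j J)) := rfl

/-- In the double sum the terms for `(i, j)` and `(j, i)` cancel by `koszulSign_mul_insert`. -/
theorem koszulD_koszulD (t : Fin n → B) (f : Finset (Fin n) → B) :
    koszulD t (koszulD t f) = 0 := by
  funext J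
  simp only [koszulD_apply, Finset.mul_sum, Pi.zero_apply]
  rw [Finset.sum_sigma']
  refine Finset.sum_involution (fun x _ => ⟨x.2, x.1⟩) ?_ ?_ ?_ ?_
  · rintro ⟨i, j⟩ h
    simp only [Finset.mem_sigma, Finset.mem_compl, Finset.mem_insert, not_or] at h
    have e : ((koszulSign i J * koszulSign j (insert i J) : ℤ) : B) =
        ((-(koszulSign j J * koszulSign i (insert j J)) : ℤ) : B) :=
      congrArg _ (koszulSign_mul_insert h.1 h.2.2 (Ne.symm h.2.1))
    push_cast at e
    rw [Finset.insert_comm j i J]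
    linear_combination (t i * t j * f (insert i (insert j J))) * e
  · rintro ⟨i, j⟩ h _ e
    simp only [Finset.mem_sigma, Finset.mem_compl, Finset.mem_insert, not_or] at h
    exact h.2.1 (congrArg Sigma.fst e)
  · rintro ⟨i, j⟩ h
    simp only [Finset.mem_sigma, Finset.mem_compl, Finset.mem_insert, not_or] at h ⊢
    exact ⟨h.2.2, fun e => h.2.1 e.symm, h.1⟩
  · rintro ⟨i, j⟩ h
    rfl

/-- Contraction of the Koszul complex in the `i`-th direction by a left inverse `D` of the
multiplication by `t i`. -/
def koszulHomotopy (i : Fin n) (D : B →+ B) (f : Finset (Fin n) → B) : Finset (Fin n) → B :=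
  fun J => if i ∈ J then (koszulSign i J : B) * D (f (J.erase i)) else 0

theorem map_intCast_mul (D : B →+ B) (k : ℤ) (b : B) : D ((k : B) * b) = (k : B) * D b := by
  rw [← zsmul_eq_mul, map_zsmul, zsmul_eq_mul]

/-- The right side is `f J` if `i ∈ J` and `t i * D (f J)` otherwise: the homotopy contracts the
components containing `i`, and where `f J = 0` it adds nothing to those that avoid `i`. -/
theorem koszulD_homotopy (t : Fin n → B) (i : Fin n) (D : B →+ B)
    (hD : ∀ b, D (t i * b) = b) (hD' : ∀ j, j ≠ i → ∀ b, D (t j * b) = t j * D b)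
    (f : Finset (Fin n) → B) (J : Finset (Fin n)) :
    koszulD t (koszulHomotopy i D f) J + koszulHomotopy i D (koszulD t f) J =
      f J - if i ∈ J then 0 else f J - t i * D (f J) := by
  by_cases hi : i ∈ J
  · obtain ⟨J, hiJ, rfl⟩ : ∃ J', i ∉ J' ∧ J = insert i J' :=
      ⟨J.erase i, Finset.notMem_erase i J, (Finset.insert_erase hi).symm⟩
    have hc : Jᶜ = insert i (insert i J)ᶜ := by
      ext j; by_cases h : j = i <;> simp [h, hiJ]
    simp only [koszulHomotopy, koszulD_apply, if_pos hi, Finset.erase_insert hiJ, sub_zero]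
    rw [hc, Finset.sum_insert (by simp), map_add, map_intCast_mul, hD, koszulSign_insert_self i hiJ,
      map_sum, mul_add, Finset.mul_sum, ← mul_assoc, ← Int.cast_mul, koszulSign_mul_self,
      Int.cast_one, one_mul, add_comm, add_assoc, ← Finset.sum_add_distrib,
      Finset.sum_eq_zero, add_zero]
    intro j hj
    simp only [Finset.mem_compl, Finset.mem_insert, not_or] at hj
    have hij : i ∉ insert j J := by simp [hiJ, Ne.symm hj.1]
    have hm : i ∈ insert j (insert i J) := by simp
    rw [if_pos hm, map_intCast_mul, hD' j hj.1, Finset.insert_comm j i, Finset.erase_insert hij,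
      koszulSign_insert_self i hij]
    have e2 : (koszulSign j (insert i J) * koszulSign i (insert j J) : ℤ) =
        -(koszulSign i J * koszulSign j J) := by
      rw [koszulSign_insert _ hiJ, koszulSign_insert _ hj.2]
      rcases lt_or_gt_of_ne hj.1 with h | h
      · rw [if_neg h.not_gt, if_pos h]; ring
      · rw [if_pos h, if_neg h.not_gt]; ring
    have e3 := congrArg (Int.cast (R := B)) e2
    push_cast at e3
    linear_combination (t j * D (f (insert j J))) * e3
  · simp only [koszulHomotopy, koszulD_apply, if_neg hi, add_zero, sub_sub_cancel]
    rw [Finset.sum_eq_single i]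
    · rw [if_pos (Finset.mem_insert_self i J), Finset.erase_insert hi, koszulSign_insert_self i hi]
      have e3 := congrArg (Int.cast (R := B)) (koszulSign_mul_self i J)
      push_cast at e3
      linear_combination (t i * D (f J)) * e3
    · intro j hj hji
      rw [if_neg (by simp [hi, Ne.symm hji]), mul_zero, mul_zero]
    · intro h
      exact absurd (Finset.mem_compl.2 hi) h

/-- The functions supported on the subsets with `m` elements. -/
def koszulChains (S B : Type*) [CommRing S] [CommRing B] [Algebra S B] (n m : ℕ) :
    Submodule S (Finset (Fin n) → B) where
  carrier := {f | ∀ J, J.card ≠ m → f J = 0}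
  zero_mem' _ _ := rfl
  add_mem' hf hg J hJ := by simp [hf J hJ, hg J hJ]
  smul_mem' s f hf J hJ := by simp [hf J hJ]

variable {S : Type*} [CommRing S] [Algebra S B]

theorem koszulD_mem (t : Fin n → B) {m : ℕ} {f : Finset (Fin n) → B}
    (hf : f ∈ koszulChains S B n (m + 1)) : koszulD t f ∈ koszulChains S B n m := by
  intro J hJ
  refine Finset.sum_eq_zero fun j hj => ?_
  rw [hf _ (by rw [Finset.card_insert_of_notMem (Finset.mem_compl.1 hj)]; omega), mul_zero,
    mul_zero]

theorem koszulHomotopy_mem (i : Fin n) (D : B →+ B) {m : ℕ} {f : Finset (Fin n) → B}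
    (hf : f ∈ koszulChains S B n m) : koszulHomotopy i D f ∈ koszulChains S B n (m + 1) := by
  intro J hJ
  unfold koszulHomotopy
  split_ifs with h
  · rw [hf _ (by rw [Finset.card_erase_of_mem h]; have := Finset.card_pos.2 ⟨i, h⟩; omega),
      map_zero, mul_zero]
  · rfl

/-- Exactness of the Koszul complex in positive degrees. -/
theorem koszul_exact (t : Fin n → B) (D : Fin n → B →+ B) (hD : ∀ i b, D i (t i * b) = b)
    (hD' : ∀ i j, j ≠ i → ∀ b, D i (t j * b) = t j * D i b) {m : ℕ} {f : Finset (Fin n) → B}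
    (hf : f ∈ koszulChains S B n (m + 1)) (hdf : koszulD t f = 0) :
    ∃ g ∈ koszulChains S B n (m + 2), koszulD t g = f := by
  -- One direction at a time: `f` is made a boundary at every `J` meeting `T`. Correcting in a new
  -- direction `i` spoils nothing, since at a `J` avoiding `i` but meeting `T` the remainder is
  -- already `0`. For `T = univ` only `J = ∅` is left, where chains of positive degree vanish.
  have key : ∀ T : Finset (Fin n), ∃ g ∈ koszulChains S B n (m + 2),
      ∀ J, (∃ i ∈ T, i ∈ J) → f J = koszulD t g J := by
    intro T
    induction T using Finset.induction_on with
    | empty => exact ⟨0, zero_mem _, by simp⟩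
    | insert i T _ ih =>
      obtain ⟨g, hg, h⟩ := ih
      have hx : f - koszulD t g ∈ koszulChains S B n (m + 1) := sub_mem hf (koszulD_mem t hg)
      have hdx : koszulD t (f - koszulD t g) = 0 := by
        rw [map_sub, hdf, koszulD_koszulD, sub_zero]
      refine ⟨g + koszulHomotopy i (D i) (f - koszulD t g),
        add_mem hg (koszulHomotopy_mem i (D i) hx), fun J hJ => ?_⟩
      have e := koszulD_homotopy t i (D i) (hD i) (hD' i) (f - koszulD t g) J
      have e0 : koszulHomotopy i (D i) (0 : Finset (Fin n) → B) J = 0 := by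
        unfold koszulHomotopy; simp
      rw [hdx, e0, add_zero] at e
      rw [map_add, Pi.add_apply, e]
      by_cases hi : i ∈ J
      · rw [if_pos hi, Pi.sub_apply]; ring
      · have : ∃ k ∈ T, k ∈ J := by
          obtain ⟨k, hk, hkJ⟩ := hJ
          rcases Finset.mem_insert.1 hk with rfl | hk
          · exact absurd hkJ hi
          · exact ⟨k, hk, hkJ⟩
        rw [if_neg hi, Pi.sub_apply, h J this]; simp
  obtain ⟨g, hg, h⟩ := key Finset.univ
  refine ⟨g, hg, ?_⟩
  funext J
  rcases J.eq_empty_or_nonempty with rfl | ⟨i, hi⟩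
  · rw [hf ∅ (by simp), koszulD_mem t hg ∅ (by simp)]
  · exact (h J ⟨i, Finset.mem_univ i, hi⟩).symm

end Koszul

/-! ### Components of graded modules -/

section Components

variable {M : Type*} [AddCommGroup M] {𝓜 : ℤ → AddSubgroup M}

/-- A family of additive projections onto the members of a spanning family of subgroups makes it a
grading. -/
theorem isInternal_of_projections (pr : ℤ → M → M)
    (hadd : ∀ k x y, pr k (x + y) = pr k x + pr k y)
    (hpr : ∀ k, ∀ m ∈ 𝓜 k, pr k m = m) (hpr' : ∀ k l, l ≠ k → ∀ m ∈ 𝓜 l, pr k m = 0)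
    (hspan : ∀ m, m ∈ ⨆ k, 𝓜 k) : DirectSum.IsInternal 𝓜 := by
  constructor
  · rw [injective_iff_map_eq_zero]
    intro x hx
    let p (k : ℤ) : M →+ M := AddMonoidHom.mk' (pr k) (hadd k)
    have key : ∀ k (y : DirectSum ℤ fun k => 𝓜 k),
        p k (DirectSum.coeAddMonoidHom 𝓜 y) = (y k : M) := by
      intro k y
      induction y using DirectSum.induction_on with
      | zero => simp
      | of l m =>
        rw [DirectSum.coeAddMonoidHom_of]
        by_cases h : l = k
        · subst h
          rw [DirectSum.of_eq_same]
          exact hpr _ _ m.2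
        · rw [DirectSum.of_eq_of_ne _ _ _ (Ne.symm h)]
          exact hpr' _ _ h _ m.2
      | add y z hy hz => rw [map_add, map_add, hy, hz]; rfl
    refine DFinsupp.ext fun k => Subtype.ext ?_
    have := key k x
    rw [hx, map_zero] at this
    exact this.symm
  · intro m
    have h : ⨆ k, 𝓜 k ≤ (DirectSum.coeAddMonoidHom 𝓜).range :=
      iSup_le fun k x hx => ⟨DirectSum.of (fun k => 𝓜 k) k ⟨x, hx⟩, by simp⟩
    exact h (hspan m)

/-- The isomorphism of a graded group with the direct sum of its homogeneous parts. -/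
def gradedEquiv (h : DirectSum.IsInternal 𝓜) : (DirectSum ℤ fun k => 𝓜 k) ≃+ M :=
  AddEquiv.ofBijective _ h

/-- The component of degree `k` of an element of a graded group. -/
def gradedComponent (h : DirectSum.IsInternal 𝓜) (k : ℤ) : M →+ M :=
  (𝓜 k).subtype.comp
    ((DFinsupp.evalAddMonoidHom k).comp (gradedEquiv h).symm.toAddMonoidHom)

variable (h : DirectSum.IsInternal 𝓜)

theorem gradedComponent_mem (k : ℤ) (m : M) : gradedComponent h k m ∈ 𝓜 k :=
  SetLike.coe_mem _

theorem gradedEquiv_symm_of_mem {k : ℤ} {m : M} (hm : m ∈ 𝓜 k) :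
    (gradedEquiv h).symm m = DirectSum.of (fun k => 𝓜 k) k ⟨m, hm⟩ := by
  rw [AddEquiv.symm_apply_eq]
  exact (DirectSum.coeAddMonoidHom_of 𝓜 k ⟨m, hm⟩).symm

theorem gradedComponent_of_mem {k : ℤ} {m : M} (hm : m ∈ 𝓜 k) : gradedComponent h k m = m := by
  have : gradedComponent h k m = ((gradedEquiv h).symm m k : M) := rfl
  rw [this, gradedEquiv_symm_of_mem h hm, DirectSum.of_eq_same]

theorem gradedComponent_of_mem_ne {k l : ℤ} (hl : l ≠ k) {m : M} (hm : m ∈ 𝓜 l) :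
    gradedComponent h k m = 0 := by
  have : gradedComponent h k m = ((gradedEquiv h).symm m k : M) := rfl
  rw [this, gradedEquiv_symm_of_mem h hm, DirectSum.of_eq_of_ne _ _ _ (Ne.symm hl)]
  rfl

include h in
/-- Induction on the homogeneous decomposition. -/
theorem homogeneous_induction {P : M → Prop} (m : M) (zero : P 0)
    (mem : ∀ k, ∀ x ∈ 𝓜 k, P x) (add : ∀ x y, P x → P y → P (x + y)) : P m := by
  obtain ⟨y, rfl⟩ := h.2 m
  induction y using DirectSum.induction_on with
  | zero => simpa using zero
  | of k x => simpa using mem k x x.2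
  | add y z hy hz => rw [map_add]; exact add _ _ hy hz

/-- The degree `0` part of a linear map between graded modules. -/
def degreeZeroPart {S N : Type*} [CommRing S] [Module S M] [AddCommGroup N] [Module S N]
    {𝒮 : ℤ → AddSubgroup S} {𝓝 : ℤ → AddSubgroup N} (h𝒮 : DirectSum.IsInternal 𝒮)
    (hM : IsGradedModule 𝒮 𝓜) (hN : IsGradedModule 𝒮 𝓝) (f : M →ₗ[S] N) : M →ₗ[S] N where
  toFun m := (DirectSum.toAddMonoid fun k =>
    ((gradedComponent hN.isInternal k).comp f.toAddMonoidHom).comp (𝓜 k).subtype)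
      ((gradedEquiv hM.isInternal).symm m)
  map_add' x y := by rw [map_add, map_add]
  map_smul' s m := by
    -- Linearity is reduced to homogeneous `s` and `m`; there it says that multiplication by `s` of
    -- degree `i` carries the component of degree `k` to that of degree `i + k`.
    have key : ∀ k, ∀ x ∈ 𝓜 k, (DirectSum.toAddMonoid fun k =>
        ((gradedComponent hN.isInternal k).comp f.toAddMonoidHom).comp (𝓜 k).subtype)
          ((gradedEquiv hM.isInternal).symm x) =
          gradedComponent hN.isInternal k (f x) := by
      intro k x hx
      rw [gradedEquiv_symm_of_mem _ hx, DirectSum.toAddMonoid_of]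
      rfl
    have comp_smul : ∀ i, ∀ s ∈ 𝒮 i, ∀ k y, gradedComponent hN.isInternal (i + k) (s • y) =
        s • gradedComponent hN.isInternal k y := by
      intro i s hs k y
      induction y using homogeneous_induction hN.isInternal with
      | zero => simp
      | mem l y hy =>
        by_cases hl : l = k
        · subst hl
          rw [gradedComponent_of_mem _ hy, gradedComponent_of_mem _ (hN.smul_mem _ _ _ _ hs hy)]
        · rw [gradedComponent_of_mem_ne _ hl hy,
            gradedComponent_of_mem_ne _ (by omega) (hN.smul_mem _ _ _ _ hs hy), smul_zero]
      | add y z hy hz => rw [smul_add, map_add, map_add, smul_add, hy, hz]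
    rw [RingHom.id_apply]
    induction m using homogeneous_induction hM.isInternal with
    | zero => simp
    | add x y hx hy => rw [smul_add, map_add, map_add, map_add, map_add, smul_add, hx, hy]
    | mem k m hm =>
      induction s using homogeneous_induction h𝒮 with
      | zero => simp
      | add x y hx hy => rw [add_smul, map_add, map_add, add_smul, hx, hy]
      | mem i s hs =>
        rw [key _ _ (hM.smul_mem _ _ _ _ hs hm), key _ _ hm, map_smul, comp_smul i s hs]

section

variable {S N : Type*} [CommRing S] [Module S M] [AddCommGroup N] [Module S N]
    {𝒮 : ℤ → AddSubgroup S} {𝓝 : ℤ → AddSubgroup N} (h𝒮 : DirectSum.IsInternal 𝒮)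
    (hM : IsGradedModule 𝒮 𝓜) (hN : IsGradedModule 𝒮 𝓝) (f : M →ₗ[S] N)

theorem degreeZeroPart_of_mem {k : ℤ} {m : M} (hm : m ∈ 𝓜 k) :
    degreeZeroPart h𝒮 hM hN f m = gradedComponent hN.isInternal k (f m) := by
  change (DirectSum.toAddMonoid _) ((gradedEquiv hM.isInternal).symm m) = _
  rw [gradedEquiv_symm_of_mem _ hm, DirectSum.toAddMonoid_of]
  rfl

theorem degreeZeroPart_mem {k : ℤ} {m : M} (hm : m ∈ 𝓜 k) : degreeZeroPart h𝒮 hM hN f m ∈ 𝓝 k := by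
  rw [degreeZeroPart_of_mem h𝒮 hM hN f hm]
  exact gradedComponent_mem _ _ _

theorem gradedComponent_map {N' : Type*} [AddCommGroup N'] {𝓝' : ℤ → AddSubgroup N'}
    (hN : DirectSum.IsInternal 𝓝) (hN' : DirectSum.IsInternal 𝓝') (g : N →+ N')
    (hg : ∀ k, ∀ x ∈ 𝓝 k, g x ∈ 𝓝' k) (k : ℤ) (x : N) :
    gradedComponent hN' k (g x) = g (gradedComponent hN k x) := by
  induction x using homogeneous_induction hN with
  | zero => simp
  | add x y hx hy => rw [map_add, map_add, map_add, map_add, hx, hy]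
  | mem l x hx =>
    by_cases hl : l = k
    · subst hl
      rw [gradedComponent_of_mem _ hx, gradedComponent_of_mem _ (hg _ _ hx)]
    · rw [gradedComponent_of_mem_ne _ hl hx, gradedComponent_of_mem_ne _ hl (hg _ _ hx), map_zero]

end

end Components

/-! ### The enveloping algebra `A[x₁,…,xₙ] ⊗[A] R = R[x₁,…,xₙ]` -/

/-- `R[x₁,…,xₙ]`, regarded as an algebra over `A[x₁,…,xₙ]` by means of the map on coefficients. -/
def EnvPoly (n : ℕ) (R : Type*) [CommRing R] := MvPolynomial (Fin n) R

namespace EnvPoly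

variable {n : ℕ} {A R : Type*} [CommRing A] [CommRing R]

instance : CommRing (EnvPoly n R) := inferInstanceAs (CommRing (MvPolynomial (Fin n) R))

/-- When `R` is itself an algebra over `A[x₁,…,xₙ]`, there is a second action on `R[x₁,…,xₙ]`,
through the constants, with `xᵢ` acting as `rᵢ`. Here `xᵢ` acts as the variable; the type synonym
keeps the two apart. -/
instance [Algebra A R] : Algebra (MvPolynomial (Fin n) A) (EnvPoly n R) :=
  RingHom.toAlgebra (MvPolynomial.map (algebraMap A R) :
    MvPolynomial (Fin n) A →+* MvPolynomial (Fin n) R)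

/-- The coefficient of `x^α`. -/
def coeff (α : Fin n →₀ ℕ) : EnvPoly n R →+ R where
  toFun p := MvPolynomial.coeff α (p : MvPolynomial (Fin n) R)
  map_zero' := MvPolynomial.coeff_zero α
  map_add' := MvPolynomial.coeff_add α

/-- The monomial `r x^α`. -/
def monomial (α : Fin n →₀ ℕ) : R →+ EnvPoly n R :=
  (MvPolynomial.monomial (σ := Fin n) (R := R) α).toAddMonoidHom

@[ext] theorem ext {p q : EnvPoly n R} (h : ∀ α, coeff α p = coeff α q) : p = q :=
  MvPolynomial.ext _ _ h

theorem coeff_monomial (α β : Fin n →₀ ℕ) (r : R) :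
    coeff α (monomial β r) = if β = α then r else 0 := MvPolynomial.coeff_monomial _ _ _

theorem coeff_mul (α : Fin n →₀ ℕ) (p q : EnvPoly n R) :
    coeff α (p * q) = ∑ x ∈ Finset.HasAntidiagonal.antidiagonal α, coeff x.1 p * coeff x.2 q :=
  MvPolynomial.coeff_mul _ _ _

theorem coeff_C_mul (α : Fin n →₀ ℕ) (r : R) (p : EnvPoly n R) :
    coeff α (monomial 0 r * p) = r * coeff α p := MvPolynomial.coeff_C_mul _ _ _

theorem coeff_algebraMap [Algebra A R] (α : Fin n →₀ ℕ) (s : MvPolynomial (Fin n) A) :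
    coeff α (algebraMap (MvPolynomial (Fin n) A) (EnvPoly n R) s) = algebraMap A R (s.coeff α) :=
  MvPolynomial.coeff_map _ _ _

theorem exists_finset_coeff (p : EnvPoly n R) :
    ∃ s : Finset (Fin n →₀ ℕ), ∀ α ∉ s, coeff α p = 0 :=
  ⟨MvPolynomial.support (p : MvPolynomial (Fin n) R), fun _ h =>
    MvPolynomial.notMem_support_iff.1 h⟩

theorem eq_sum_monomial (p : EnvPoly n R) {s : Finset (Fin n →₀ ℕ)}
    (h : ∀ α ∉ s, coeff α p = 0) : p = ∑ α ∈ s, monomial α (coeff α p) := by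
  classical
  ext β
  simp only [map_sum, coeff_monomial, Finset.sum_ite_eq']
  split_ifs with hb
  · rfl
  · exact h β hb

theorem mem_of_monomial_mem {P : AddSubgroup (EnvPoly n R)} (p : EnvPoly n R)
    (h : ∀ α, monomial α (coeff α p) ∈ P) : p ∈ P := by
  obtain ⟨s, hs⟩ := exists_finset_coeff p
  rw [eq_sum_monomial p hs]
  exact sum_mem fun α _ => h α

/-- Apply an additive map `φ α` to the coefficient of `x^α`, for all `α`. -/
def mapCoeff {A' : Type*} [CommRing A'] (φ : (Fin n →₀ ℕ) → R →+ A') (p : EnvPoly n R) :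
    MvPolynomial (Fin n) A' :=
  ∑ α ∈ MvPolynomial.support (p : MvPolynomial (Fin n) R),
    MvPolynomial.monomial α (φ α (coeff α p))

theorem coeff_mapCoeff {A' : Type*} [CommRing A'] (φ : (Fin n →₀ ℕ) → R →+ A')
    (p : EnvPoly n R) (α : Fin n →₀ ℕ) : (mapCoeff φ p).coeff α = φ α (coeff α p) := by
  classical
  simp only [mapCoeff, MvPolynomial.coeff_sum, MvPolynomial.coeff_monomial, Finset.sum_ite_eq']
  split_ifs with h
  · rfl
  · have : coeff α p = 0 := MvPolynomial.notMem_support_iff.1 h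
    rw [this, map_zero]

section Trace

variable [Algebra A R]

/-- The base change `A[x₁,…,xₙ] ⊗ R → A[x₁,…,xₙ]` of a functional `ρ : R → A`. -/
def trace (ρ : R →ₗ[A] A) : EnvPoly n R →ₗ[MvPolynomial (Fin n) A] MvPolynomial (Fin n) A where
  toFun p := mapCoeff (fun _ => ρ.toAddMonoidHom) p
  map_add' p q := MvPolynomial.ext _ _ fun α => by
    rw [MvPolynomial.coeff_add]
    simp only [coeff_mapCoeff, map_add]
  map_smul' s p := MvPolynomial.ext _ _ fun α => by
    rw [coeff_mapCoeff, RingHom.id_apply, smul_eq_mul, MvPolynomial.coeff_mul,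
      Algebra.smul_def, coeff_mul, map_sum]
    refine Finset.sum_congr rfl fun x _ => ?_
    rw [coeff_algebraMap, ← Algebra.smul_def, coeff_mapCoeff]
    exact ρ.map_smul _ _

theorem coeff_trace (ρ : R →ₗ[A] A) (p : EnvPoly n R) (α : Fin n →₀ ℕ) :
    (trace ρ p).coeff α = ρ (coeff α p) :=
  coeff_mapCoeff (fun _ => ρ.toAddMonoidHom) p α

theorem trace_monomial (ρ : R →ₗ[A] A) (α : Fin n →₀ ℕ) (r : R) :
    trace ρ (monomial α r) = MvPolynomial.monomial α (ρ r) := by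
  classical
  ext β
  rw [coeff_trace, coeff_monomial, MvPolynomial.coeff_monomial]
  split_ifs <;> simp

theorem monomial_eq_smul (α : Fin n →₀ ℕ) (r : R) :
    (monomial α r : EnvPoly n R) =
      (MvPolynomial.monomial α 1 : MvPolynomial (Fin n) A) • monomial 0 r := by
  rw [Algebra.smul_def]
  have h : (MvPolynomial.monomial α r : MvPolynomial (Fin n) R) =
      MvPolynomial.map (algebraMap A R) (MvPolynomial.monomial α 1) *
        MvPolynomial.monomial 0 r := by
    rw [MvPolynomial.map_monomial, MvPolynomial.monomial_mul]
    simp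
  exact h

theorem monomial_zero_smul (a : A) (r : R) :
    (monomial 0 (a • r) : EnvPoly n R) =
      (MvPolynomial.C a : MvPolynomial (Fin n) A) • monomial 0 r := by
  rw [Algebra.smul_def (MvPolynomial.C a)]
  have h : (MvPolynomial.monomial 0 (a • r) : MvPolynomial (Fin n) R) =
      MvPolynomial.map (algebraMap A R) (MvPolynomial.C a) * MvPolynomial.monomial 0 r := by
    rw [MvPolynomial.map_C, MvPolynomial.C_mul_monomial, Algebra.smul_def]
  exact h

/-- The constants generate `R[x₁,…,xₙ]` over `A[x₁,…,xₙ]`. -/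
theorem hom_ext {N : Type*} [AddCommGroup N] [Module (MvPolynomial (Fin n) A) N]
    {f g : EnvPoly n R →ₗ[MvPolynomial (Fin n) A] N}
    (h : ∀ r, f (monomial 0 r) = g (monomial 0 r)) : f = g := by
  ext p
  obtain ⟨s, hs⟩ := exists_finset_coeff p
  rw [eq_sum_monomial p hs, map_sum, map_sum]
  refine Finset.sum_congr rfl fun α _ => ?_
  rw [monomial_eq_smul (A := A), map_smul, map_smul, h]

/-- The functional `q ↦ trace (p q)`. -/
def traceMul (ρ : R →ₗ[A] A) (p : EnvPoly n R) :
    EnvPoly n R →ₗ[MvPolynomial (Fin n) A] MvPolynomial (Fin n) A :=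
  trace ρ ∘ₗ LinearMap.mulLeft _ p

theorem traceMul_apply (ρ : R →ₗ[A] A) (p q : EnvPoly n R) :
    traceMul ρ p q = trace ρ (p * q) := rfl

variable {ρ : R →ₗ[A] A} (hρ : ((LinearMap.mul A R).compr₂ ρ).IsPerfPair)

-- Testing on a constant `r`, the coefficient of `x^α` in the trace of `p * r` is `ρ (p_α r)`, so
-- injectivity of the pairing on `R` applies to each coefficient of `p`.
include hρ in
theorem eq_zero_of_traceMul {p : EnvPoly n R} (hp : traceMul ρ p = 0) : p = 0 := by
  ext α
  rw [map_zero]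
  apply hρ.bijective_left.1
  ext r
  have h : (traceMul ρ p (monomial 0 r)).coeff α = 0 := by rw [hp]; simp
  rw [traceMul_apply, mul_comm, coeff_trace, coeff_C_mul] at h
  simpa [mul_comm] using h

-- On constants, the coefficient of `x^α` in `f` is a functional on `R`, hence `ρ (m α * ·)` for
-- some `m α`. Finite generation of `R` leaves only finitely many nonzero `m α`, so they are the
-- coefficients of a polynomial.
include hρ in
theorem exists_traceMul_eq [Module.Finite A R]
    (f : EnvPoly n R →ₗ[MvPolynomial (Fin n) A] MvPolynomial (Fin n) A) :
    ∃ p, traceMul ρ p = f := by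
  classical
  obtain ⟨G, hG⟩ := Module.Finite.fg_top (R := A) (M := R)
  let φ (α : Fin n →₀ ℕ) : R →ₗ[A] A :=
    { toFun r := (f (monomial 0 r)).coeff α
      map_add' r r' := by rw [map_add, map_add, MvPolynomial.coeff_add]
      map_smul' a r := by
        rw [monomial_zero_smul, map_smul, smul_eq_mul, MvPolynomial.coeff_C_mul]; rfl }
  choose m hm using fun α => hρ.bijective_left.2 (φ α)
  let s : Finset (Fin n →₀ ℕ) := G.biUnion fun r => (f (monomial 0 r)).support
  have hs : ∀ α ∉ s, φ α = 0 := by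
    intro α hα
    refine LinearMap.ext_on hG fun r hr => ?_
    by_contra h
    exact hα (Finset.mem_biUnion.2 ⟨r, hr, MvPolynomial.mem_support_iff.2 h⟩)
  have hm0 : ∀ α ∉ s, m α = 0 := fun α hα => hρ.bijective_left.1 (by rw [hm, hs α hα, map_zero])
  refine ⟨∑ α ∈ s, monomial α (m α), hom_ext fun r => ?_⟩
  ext α
  have hc : coeff α (∑ α ∈ s, (monomial α (m α) : EnvPoly n R)) = m α := by
    simp only [map_sum, coeff_monomial, Finset.sum_ite_eq']
    split_ifs with h
    · rfl
    · exact (hm0 α h).symm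
  rw [traceMul_apply, mul_comm, coeff_trace, coeff_C_mul, hc, mul_comm]
  exact LinearMap.congr_fun (hm α) r

-- A splitting of `A^m → R` has coordinate functionals of the form `ρ (c i * ·)`; the corresponding
-- traces are coordinate functionals that split `S^m → B`.
include hρ in
theorem projective [Module.Finite A R] [Module.Projective A R] :
    Module.Projective (MvPolynomial (Fin n) A) (EnvPoly n R) := by
  obtain ⟨m, f, g, -, -, hfg⟩ := Module.Finite.exists_comp_eq_id_of_projective A R
  choose c hc using fun i => hρ.bijective_left.2 (LinearMap.proj i ∘ₗ g)
  refine Module.Projective.of_split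
    (LinearMap.pi fun i => traceMul ρ (monomial 0 (c i)))
    (Fintype.linearCombination (MvPolynomial (Fin n) A)
      (fun i => (monomial 0 (f (Pi.single i 1)) : EnvPoly n R))) (hom_ext fun r => ?_)
  rw [LinearMap.comp_apply, Fintype.linearCombination_apply, LinearMap.id_apply]
  have h : ∀ i, traceMul ρ (monomial 0 (c i)) (monomial 0 r) =
      (MvPolynomial.C (g r i) : MvPolynomial (Fin n) A) := by
    intro i
    have e : (monomial 0 (c i) * monomial 0 r : EnvPoly n R) = monomial 0 (c i * r) :=
      (MvPolynomial.C_mul (σ := Fin n)).symm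
    rw [traceMul_apply, e, trace_monomial]
    exact congrArg _ (LinearMap.congr_fun (hc i) r)
  simp only [LinearMap.pi_apply, h, ← monomial_zero_smul]
  rw [← map_sum]
  congr 1
  have : g r = ∑ i, g r i • (Pi.single i 1 : Fin m → A) := by
    simpa using (pi_eq_sum_univ' (g r))
  conv_rhs => rw [← LinearMap.id_apply (R := A) r, ← hfg, LinearMap.comp_apply, this, map_sum]
  simp only [map_smul]

end Trace

end EnvPoly

namespace EnvPoly

variable {n : ℕ} {A R : Type*} [CommRing A] [CommRing R]

/-! ### The augmentation and the regular sequence generating its kernel -/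

section Augmentation

/-- The element `xᵢ - rᵢ`. -/
def koszulElement (r : Fin n → R) (i : Fin n) : EnvPoly n R :=
  (MvPolynomial.X i - MvPolynomial.C (r i) : MvPolynomial (Fin n) R)

/-- The factor theorem in several variables: modulo all `xᵢ - rᵢ` a polynomial equals its value at
`r`. -/
theorem sub_C_eval_mem_span (r : Fin n → R) (p : MvPolynomial (Fin n) R) :
    p - MvPolynomial.C (MvPolynomial.eval r p) ∈
      Ideal.span (Set.range fun i => (MvPolynomial.X i - MvPolynomial.C (r i))) := by
  induction p using MvPolynomial.induction_on with
  | C a => simp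
  | add p q hp hq =>
    have : p + q - MvPolynomial.C (MvPolynomial.eval r (p + q)) =
        (p - MvPolynomial.C (MvPolynomial.eval r p)) +
          (q - MvPolynomial.C (MvPolynomial.eval r q)) := by
      rw [map_add, map_add]; ring
    rw [this]
    exact add_mem hp hq
  | mul_X p i hp =>
    have : p * MvPolynomial.X i - MvPolynomial.C (MvPolynomial.eval r (p * MvPolynomial.X i)) =
        MvPolynomial.X i * (p - MvPolynomial.C (MvPolynomial.eval r p)) +
          MvPolynomial.C (MvPolynomial.eval r p) * (MvPolynomial.X i - MvPolynomial.C (r i)) := by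
      rw [map_mul, MvPolynomial.eval_X, map_mul]; ring
    rw [this]
    exact add_mem (Ideal.mul_mem_left _ _ hp)
      (Ideal.mul_mem_left _ _ (Ideal.subset_span ⟨i, rfl⟩))

/-- Translation of the variables by `r`. -/
def translate (r : Fin n → R) : MvPolynomial (Fin n) R →ₐ[R] MvPolynomial (Fin n) R :=
  MvPolynomial.aeval fun i => MvPolynomial.X i + MvPolynomial.C (r i)

theorem translate_neg_translate (r : Fin n → R) (p : MvPolynomial (Fin n) R) :
    translate (-r) (translate r p) = p := by
  have : (translate (-r)).comp (translate r) = AlgHom.id R _ := by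
    ext i
    simp [translate]
  exact congrArg (fun f => f p) this

/-- Division by `xᵢ - rᵢ`. -/
def koszulDiv (r : Fin n → R) (i : Fin n) : EnvPoly n R →+ EnvPoly n R where
  toFun p := translate (-r) (MvPolynomial.divMonomial (translate r p) (Finsupp.single i 1))
  map_zero' := by
    rw [show translate r (0 : EnvPoly n R) = 0 from map_zero (translate r),
      MvPolynomial.zero_divMonomial]
    exact map_zero _
  map_add' p q := by
    rw [show translate r (p + q : EnvPoly n R) = translate r p + translate r q from
      map_add (translate r) _ _, MvPolynomial.add_divMonomial]
    exact map_add _ _ _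

/-- After translation, dividing by `xᵢ - rᵢ` becomes dividing by the monomial `xᵢ` and dropping the
remainder. -/
theorem translate_X_sub_C_mul (r : Fin n → R) (i : Fin n) (p : MvPolynomial (Fin n) R) :
    translate r ((MvPolynomial.X i - MvPolynomial.C (r i)) * p) =
      MvPolynomial.X i * translate r p := by
  simp [translate]

theorem translate_div_X_sub_C_mul (r : Fin n → R) (i : Fin n) (p : MvPolynomial (Fin n) R) :
    translate (-r) (MvPolynomial.divMonomial (translate r
      ((MvPolynomial.X i - MvPolynomial.C (r i)) * p)) (Finsupp.single i 1)) = p := by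
  rw [translate_X_sub_C_mul, MvPolynomial.X_mul_divMonomial, translate_neg_translate]

theorem koszulDiv_mul_self (r : Fin n → R) (i : Fin n) (p : EnvPoly n R) :
    koszulDiv r i (koszulElement r i * p) = p :=
  translate_div_X_sub_C_mul r i p

theorem X_mul_divMonomial_of_ne {i j : Fin n} (hij : j ≠ i) (p : MvPolynomial (Fin n) R) :
    MvPolynomial.divMonomial (MvPolynomial.X j * p) (Finsupp.single i 1) =
      MvPolynomial.X j * MvPolynomial.divMonomial p (Finsupp.single i 1) := by
  ext α
  rw [MvPolynomial.coeff_divMonomial, MvPolynomial.coeff_X_mul', MvPolynomial.coeff_X_mul']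
  have h : j ∈ (Finsupp.single i 1 + α).support ↔ j ∈ α.support := by
    simp [hij.symm]
  simp only [h]
  split_ifs with hj
  · rw [MvPolynomial.coeff_divMonomial]
    congr 1
    rw [add_tsub_assoc_of_le]
    rw [Finsupp.single_le_iff]
    exact Nat.one_le_iff_ne_zero.2 (Finsupp.mem_support_iff.1 hj)
  · rfl

theorem translate_div_X_sub_C_mul_of_ne (r : Fin n → R) {i j : Fin n} (hij : j ≠ i)
    (p : MvPolynomial (Fin n) R) :
    translate (-r) (MvPolynomial.divMonomial (translate r
      ((MvPolynomial.X j - MvPolynomial.C (r j)) * p)) (Finsupp.single i 1)) =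
      (MvPolynomial.X j - MvPolynomial.C (r j)) *
        translate (-r) (MvPolynomial.divMonomial (translate r p) (Finsupp.single i 1)) := by
  rw [translate_X_sub_C_mul, X_mul_divMonomial_of_ne hij, map_mul]
  simp [translate, sub_eq_add_neg]

/-- Division by one variable only shifts its own exponent, so it commutes with multiplication by
another; this and `koszulDiv_mul_self` are what `koszul_exact` requires. -/
theorem koszulDiv_mul_of_ne (r : Fin n → R) (i j : Fin n) (hij : j ≠ i) (p : EnvPoly n R) :
    koszulDiv r i (koszulElement r j * p) = koszulElement r j * koszulDiv r i p :=
  translate_div_X_sub_C_mul_of_ne r hij p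

theorem eval_X_sub_C (r : Fin n → R) (i : Fin n) :
    MvPolynomial.eval r (MvPolynomial.X i - MvPolynomial.C (r i)) = 0 := by
  simp

theorem exists_sum_X_sub_C_of_eval_eq_zero {r : Fin n → R} {p : MvPolynomial (Fin n) R}
    (hp : MvPolynomial.eval r p = 0) : ∃ c : Fin n → MvPolynomial (Fin n) R,
      ∑ i, (MvPolynomial.X i - MvPolynomial.C (r i)) * c i = p := by
  have h := sub_C_eval_mem_span r p
  rw [hp, map_zero, sub_zero, Ideal.mem_span_range_iff_exists_fun] at h
  obtain ⟨c, hc⟩ := h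
  exact ⟨c, by simpa only [mul_comm] using hc⟩

section

variable [Algebra A R] [Algebra (MvPolynomial (Fin n) A) R]
  [IsScalarTower A (MvPolynomial (Fin n) A) R]

theorem algebraMap_eq_eval₂ (s : MvPolynomial (Fin n) A) :
    algebraMap (MvPolynomial (Fin n) A) R s =
      MvPolynomial.eval₂ (algebraMap A R)
        (fun i => algebraMap (MvPolynomial (Fin n) A) R (MvPolynomial.X i)) s := by
  have : (IsScalarTower.toAlgHom A (MvPolynomial (Fin n) A) R) =
      MvPolynomial.aeval (fun i => algebraMap (MvPolynomial (Fin n) A) R (MvPolynomial.X i)) := by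
    ext i
    simp
  exact congrArg (fun f => f s) this

variable (n A R) in
/-- The elements `xᵢ ⊗ 1 - 1 ⊗ xᵢ`. -/
abbrev diagonalElement : Fin n → EnvPoly n R :=
  koszulElement fun i => algebraMap (MvPolynomial (Fin n) A) R (MvPolynomial.X i)

variable (n A R) in
/-- The augmentation `A[x₁,…,xₙ] ⊗ R → R`, `s ⊗ r ↦ s r`. -/
def augmentation : EnvPoly n R →ₗ[MvPolynomial (Fin n) A] R where
  toFun p := MvPolynomial.eval
    (fun i => algebraMap (MvPolynomial (Fin n) A) R (MvPolynomial.X i))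
    (p : MvPolynomial (Fin n) R)
  map_add' p q := map_add (MvPolynomial.eval _) _ _
  map_smul' s p := by
    rw [Algebra.smul_def, RingHom.id_apply, Algebra.smul_def, algebraMap_eq_eval₂ (R := R) s,
      ← MvPolynomial.eval_map]
    exact map_mul (MvPolynomial.eval _) _ _

theorem augmentation_mul (p q : EnvPoly n R) :
    augmentation n A R (p * q) = augmentation n A R p * augmentation n A R q :=
  map_mul (MvPolynomial.eval _) _ _

theorem augmentation_monomial (α : Fin n →₀ ℕ) (r : R) :
    augmentation n A R (monomial α r) =
      r * algebraMap (MvPolynomial (Fin n) A) R (MvPolynomial.monomial α 1) := by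
  rw [algebraMap_eq_eval₂, MvPolynomial.eval₂_monomial, map_one, one_mul]
  exact MvPolynomial.eval_monomial

theorem augmentation_surjective : Function.Surjective (augmentation n A R) := fun r =>
  ⟨monomial 0 r, MvPolynomial.eval_C r⟩

theorem augmentation_diagonalElement (i : Fin n) :
    augmentation n A R (diagonalElement n A R i) = 0 :=
  eval_X_sub_C (fun i => algebraMap (MvPolynomial (Fin n) A) R (MvPolynomial.X i)) i

theorem exists_eq_sum_of_augmentation_eq_zero {p : EnvPoly n R} (hp : augmentation n A R p = 0) :
    ∃ c : Fin n → EnvPoly n R, ∑ i, diagonalElement n A R i * c i = p :=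
  exists_sum_X_sub_C_of_eval_eq_zero hp

end

end Augmentation

/-! ### The grading -/

section Grading

variable [Algebra A R] (𝓡 : ℤ → Submodule A R) (δ : Fin n → ℕ)

/-- The degree of the monomial `x^α`. -/
def weight (δ : Fin n → ℕ) : (Fin n →₀ ℕ) →+ ℤ := Finsupp.weight fun i => (δ i : ℤ)

/-- The grading of `A[x₁,…,xₙ] ⊗ R`. -/
def grading (k : ℤ) : AddSubgroup (EnvPoly n R) where
  carrier := {p | ∀ α, coeff α p ∈ 𝓡 (k - weight δ α)}
  zero_mem' α := by rw [map_zero]; exact zero_mem _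
  add_mem' hp hq α := by rw [map_add]; exact add_mem (hp α) (hq α)
  neg_mem' hp α := by rw [map_neg]; exact neg_mem (hp α)

variable {𝓡 δ}

theorem monomial_mem_grading {k : ℤ} {α : Fin n →₀ ℕ} {r : R} (hr : r ∈ 𝓡 (k - weight δ α)) :
    monomial α r ∈ grading 𝓡 δ k := by
  classical
  intro β
  rw [coeff_monomial]
  split_ifs with h
  · exact h ▸ hr
  · exact zero_mem _

theorem mem_polyGrading {k : ℤ} {s : MvPolynomial (Fin n) A} :
    s ∈ polyGrading A δ k ↔ ∀ α, s.coeff α ≠ 0 → weight δ α = k := by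
  change s ∈ MvPolynomial.weightedHomogeneousSubmodule A (fun i => (δ i : ℤ)) k ↔ _
  rw [MvPolynomial.mem_weightedHomogeneousSubmodule]
  exact Iff.rfl

/-- If `ρ` does not kill the coefficient of `x^α`, that coefficient lies in degree `d`, which forces
`x^α` to have degree `k - d`. -/
theorem trace_mem_polyGrading {d : ℕ} {ρ : R →ₗ[A] A}
    (hρ : ∀ k : ℤ, k ≠ d → ∀ r ∈ 𝓡 k, ρ r = 0) {k : ℤ} {p : EnvPoly n R}
    (hp : p ∈ grading 𝓡 δ k) : trace ρ p ∈ polyGrading A δ (k - d) := by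
  rw [mem_polyGrading]
  intro α h
  rw [coeff_trace] at h
  by_contra h'
  exact h (hρ (k - weight δ α) (by omega) _ (hp α))

/-- The component of degree `k` for the grading of `A[x₁,…,xₙ] ⊗ R`. -/
def component (h : DirectSum.IsInternal fun k => (𝓡 k).toAddSubgroup) (δ : Fin n → ℕ) (k : ℤ)
    (p : EnvPoly n R) : EnvPoly n R :=
  mapCoeff (fun α => gradedComponent h (k - weight δ α)) p

theorem coeff_component (h : DirectSum.IsInternal fun k => (𝓡 k).toAddSubgroup) (δ : Fin n → ℕ)
    (k : ℤ) (p : EnvPoly n R) (α : Fin n →₀ ℕ) :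
    coeff α (component h δ k p) = gradedComponent h (k - weight δ α) (coeff α p) :=
  coeff_mapCoeff _ _ _

variable [GradedAlgebra 𝓡]

theorem isInternal_toAddSubgroup :
    DirectSum.IsInternal fun k => (𝓡 k).toAddSubgroup :=
  DirectSum.Decomposition.isInternal 𝓡

variable (𝓡 δ) in
theorem isInternal_grading : DirectSum.IsInternal (grading (n := n) 𝓡 δ) := by
  have h𝓡 := isInternal_toAddSubgroup (𝓡 := 𝓡)
  refine isInternal_of_projections (component h𝓡 δ)
    (fun k p q => EnvPoly.ext fun α => ?_) (fun k p hp => EnvPoly.ext fun α => ?_)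
    (fun k l hl p hp => EnvPoly.ext fun α => ?_) (fun p => ?_)
  · simp only [map_add, coeff_component]
  · rw [coeff_component]
    exact gradedComponent_of_mem _ (hp α)
  · rw [coeff_component, map_zero]
    exact gradedComponent_of_mem_ne _ (by omega) (hp α)
  · refine mem_of_monomial_mem p fun α => ?_
    induction coeff α p using homogeneous_induction h𝓡 with
    | zero => rw [map_zero]; exact zero_mem _
    | add x y hx hy => rw [map_add]; exact add_mem hx hy
    | mem l x hx =>
      refine AddSubgroup.mem_iSup_of_mem (l + weight δ α) (monomial_mem_grading ?_)
      rw [add_sub_cancel_right]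
      exact hx

theorem mul_mem_grading {k l : ℤ} {p q : EnvPoly n R} (hp : p ∈ grading 𝓡 δ k)
    (hq : q ∈ grading 𝓡 δ l) : p * q ∈ grading 𝓡 δ (k + l) := by
  intro α
  rw [coeff_mul]
  refine sum_mem fun x hx => ?_
  have h : k + l - weight δ α = (k - weight δ x.1) + (l - weight δ x.2) := by
    rw [← Finset.HasAntidiagonal.mem_antidiagonal.1 hx, map_add]; ring
  rw [h]
  exact SetLike.mul_mem_graded (hp _) (hq _)

theorem algebraMap_mem_grading {k : ℤ} {s : MvPolynomial (Fin n) A} (hs : s ∈ polyGrading A δ k) :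
    algebraMap (MvPolynomial (Fin n) A) (EnvPoly n R) s ∈ grading 𝓡 δ k := by
  intro α
  rw [coeff_algebraMap]
  by_cases h : s.coeff α = 0
  · rw [h, map_zero]; exact zero_mem _
  · rw [mem_polyGrading.1 hs α h, sub_self]
    exact SetLike.algebraMap_mem_graded 𝓡 _

theorem smul_mem_grading {k l : ℤ} {s : MvPolynomial (Fin n) A} {p : EnvPoly n R}
    (hs : s ∈ polyGrading A δ k) (hp : p ∈ grading 𝓡 δ l) : s • p ∈ grading 𝓡 δ (k + l) := by
  rw [Algebra.smul_def]
  exact mul_mem_grading (algebraMap_mem_grading hs) hp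

theorem koszulElement_mem_grading {r : Fin n → R} {i : Fin n} (hr : r i ∈ 𝓡 (δ i)) :
    koszulElement r i ∈ grading 𝓡 δ (δ i) := by
  have h : koszulElement r i = monomial (Finsupp.single i 1) 1 - monomial 0 (r i) := rfl
  rw [h]
  refine sub_mem (monomial_mem_grading ?_) (monomial_mem_grading ?_)
  · have : weight δ (Finsupp.single i 1) = δ i := by simp [weight, Finsupp.weight_single]
    rw [this, sub_self]
    exact SetLike.one_mem_graded 𝓡
  · rw [map_zero, sub_zero]
    exact hr

theorem isInternal_polyGrading : DirectSum.IsInternal (polyGrading A δ) :=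
  let _ := MvPolynomial.weightedDecomposition A fun i => (δ i : ℤ)
  DirectSum.Decomposition.isInternal
    (MvPolynomial.weightedHomogeneousSubmodule A fun i => (δ i : ℤ))

variable [Algebra (MvPolynomial (Fin n) A) R] [IsScalarTower A (MvPolynomial (Fin n) A) R]

theorem augmentation_mem
    (hgraded : ∀ (k : ℤ) (s : MvPolynomial (Fin n) A), s ∈ polyGrading A δ k →
      algebraMap (MvPolynomial (Fin n) A) R s ∈ 𝓡 k)
    {k : ℤ} {p : EnvPoly n R} (hp : p ∈ grading 𝓡 δ k) : augmentation n A R p ∈ 𝓡 k := by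
  obtain ⟨s, hs⟩ := exists_finset_coeff p
  rw [eq_sum_monomial p hs, map_sum]
  refine sum_mem fun α _ => ?_
  rw [augmentation_monomial]
  have h : algebraMap (MvPolynomial (Fin n) A) R (MvPolynomial.monomial α 1) ∈
      𝓡 (weight δ α) := by
    classical
    refine hgraded _ _ (mem_polyGrading.2 fun β hβ => ?_)
    rw [MvPolynomial.coeff_monomial] at hβ
    split_ifs at hβ with e
    · rw [e]
    · exact absurd rfl hβ
  have := SetLike.mul_mem_graded (hp α) h
  rwa [sub_add_cancel] at this

end Grading

end EnvPoly

open EnvPoly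

/-! ### Projective resolutions from exact sequences of modules -/

section OfExact

variable {S : Type u} [CommRing S] (X : ℕ → ModuleCat.{u} S) (d : ∀ m, X (m + 1) ⟶ X m)
  (hd : ∀ m, d (m + 1) ≫ d m = 0) {Z : ModuleCat.{u} S} (ε : X 0 ⟶ Z) (hε : d 0 ≫ ε = 0)

theorem chainComplex_of_d (m : ℕ) : (ChainComplex.of X d hd).d (m + 1) m = d m :=
  ChainComplex.of_d X d m

/-- The augmentation of a complex of modules. -/
def augmentComplex : ChainComplex.of X d hd ⟶ (ChainComplex.single₀ (ModuleCat.{u} S)).obj Z :=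
  (ChainComplex.toSingle₀Equiv _ _).symm
    ⟨ε, (congrArg (· ≫ ε) (chainComplex_of_d X d hd 0)).trans hε⟩

theorem augmentComplex_f_zero : (augmentComplex X d hd ε hε).f 0 = ε :=
  ChainComplex.toSingle₀Equiv_symm_apply_f_zero _ _

/-- In degree `0` the condition is exactness of `X 1 → X 0 → Z → 0`; in positive degrees the target
complex vanishes and only exactness of the source remains. -/
theorem quasiIso_augmentComplex
    (hex : ∀ m (x : X (m + 1)), (d m).hom x = 0 → ∃ y, (d (m + 1)).hom y = x)
    (hex0 : ∀ x : X 0, ε.hom x = 0 → ∃ y, (d 0).hom y = x)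
    (hsurj : Function.Surjective ε.hom) : QuasiIso (augmentComplex X d hd ε hε) where
  quasiIsoAt m := by
    cases m with
    | zero =>
      rw [ChainComplex.quasiIsoAt₀_iff, ShortComplex.quasiIso_iff_of_zeros']
      · refine (ShortComplex.exact_and_epi_g_iff_of_iso (S₂ := ShortComplex.mk (d 0) ε hε) ?_).2
          ⟨?_, (ModuleCat.epi_iff_surjective ε).2 hsurj⟩
        · exact ShortComplex.isoMk (Iso.refl _) (Iso.refl _) (Iso.refl _)
            ((Category.id_comp (d 0)).trans
              ((ChainComplex.of_d X d 0).symm.trans (Category.comp_id _).symm))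
            ((Category.id_comp ε).trans
              ((augmentComplex_f_zero X d hd ε hε).symm.trans (Category.comp_id _).symm))
        · rw [ShortComplex.moduleCat_exact_iff]
          exact hex0
      all_goals rfl
    | succ m =>
      rw [quasiIsoAt_iff_exactAt' _ _ (ChainComplex.exactAt_succ_single_obj _ _),
        HomologicalComplex.exactAt_iff' _ (m + 1 + 1) (m + 1) m (by simp) (by simp),
        ShortComplex.moduleCat_exact_iff]
      simp only [HomologicalComplex.sc', HomologicalComplex.shortComplexFunctor',
        ChainComplex.of_d]
      exact hex m

end OfExact

/-! ### The graded Koszul resolution of `R` over `A[x₁,…,xₙ]` -/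

section KoszulModule

variable {n : ℕ} {S B : Type*} [CommRing S] [CommRing B] [Algebra S B]

/-- The Koszul differential as a map between chains of consecutive degrees. -/
def koszulMap (S : Type*) [CommRing S] [Algebra S B] (t : Fin n → B) (m : ℕ) :
    koszulChains S B n (m + 1) →ₗ[S] koszulChains S B n m :=
  ((koszulD t).restrictScalars S).restrict fun _ hf => koszulD_mem t hf

theorem koszulMap_apply (t : Fin n → B) (m : ℕ) (f : koszulChains S B n (m + 1)) :
    (koszulMap S t m f : Finset (Fin n) → B) = koszulD t f := rfl

/-- The chain with value `b` at `J`. -/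
def koszulSingle (S : Type*) [CommRing S] [Algebra S B] {m : ℕ} (J : Finset (Fin n))
    (hJ : J.card = m) : B →ₗ[S] koszulChains S B n m :=
  (LinearMap.single S (fun _ : Finset (Fin n) => B) J).codRestrict _ fun b J' hJ' => by
    rw [LinearMap.single_apply, Pi.single_eq_of_ne]
    rintro rfl
    exact hJ' hJ

theorem koszulSingle_apply {m : ℕ} (J : Finset (Fin n)) (hJ : J.card = m) (b : B)
    (J' : Finset (Fin n)) :
    (koszulSingle S J hJ b : Finset (Fin n) → B) J' = if J' = J then b else 0 := by
  change (LinearMap.single S (fun _ : Finset (Fin n) => B) J b) J' = _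
  rw [LinearMap.single_apply, Pi.single_apply]

theorem koszulD_koszulSingle_singleton (t : Fin n → B) (i : Fin n) (b : B) :
    koszulD t (koszulSingle S {i} (Finset.card_singleton i) b : koszulChains S B n 1) ∅ =
      t i * b := by
  rw [koszulD_apply, Finset.sum_eq_single i]
  · rw [koszulSingle_apply, if_pos (insert_empty_eq i)]
    simp [koszulSign]
  · intro j _ hj
    rw [koszulSingle_apply, if_neg (by simpa using hj), mul_zero, mul_zero]
  · intro h
    simp at h

theorem koszulChains_eq_sum {m : ℕ} (f : koszulChains S B n m) :
    f = ∑ J : {J : Finset (Fin n) // J.card = m}, koszulSingle S J.1 J.2 (f.1 J.1) := by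
  refine Subtype.ext (funext fun J => ?_)
  rw [AddSubmonoidClass.coe_finsetSum, Finset.sum_apply]
  simp only [koszulSingle_apply]
  by_cases hJ : J.card = m
  · rw [Finset.sum_eq_single ⟨J, hJ⟩]
    · simp
    · rintro ⟨J', hJ'⟩ - h
      rw [if_neg]
      rintro rfl
      exact h rfl
    · intro h
      exact absurd (Finset.mem_univ _) h
  · rw [f.2 J hJ, Finset.sum_eq_zero]
    rintro ⟨J', hJ'⟩ -
    rw [if_neg]
    rintro rfl
    exact hJ hJ'

/-- The chains are a retract of the direct sum of copies of `B` indexed by the `m`-element subsets.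
-/
theorem projective_koszulChains [Module.Projective S B] (m : ℕ) :
    Module.Projective S (koszulChains S B n m) := by
  classical
  refine Module.Projective.of_split
    (M := DirectSum {J : Finset (Fin n) // J.card = m} fun _ => B)
    ((DirectSum.linearEquivFunOnFintype S _ _).symm.toLinearMap ∘ₗ
      LinearMap.pi fun J : {J : Finset (Fin n) // J.card = m} =>
        LinearMap.proj J.1 ∘ₗ (koszulChains S B n m).subtype)
    (DirectSum.toModule S _ _ fun J : {J : Finset (Fin n) // J.card = m} =>
      koszulSingle S J.1 J.2) ?_
  ext1 f
  conv_rhs => rw [LinearMap.id_apply, koszulChains_eq_sum f]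
  rw [LinearMap.comp_apply]
  generalize hg : ((DirectSum.linearEquivFunOnFintype S _ _).symm.toLinearMap ∘ₗ
      LinearMap.pi fun J : {J : Finset (Fin n) // J.card = m} =>
        LinearMap.proj J.1 ∘ₗ (koszulChains S B n m).subtype) f = g
  have hg' : ∀ J : {J : Finset (Fin n) // J.card = m}, g J = f.1 J.1 := by
    intro J
    rw [← hg]
    rfl
  conv_lhs => rw [← DirectSum.sum_univ_of g]
  rw [map_sum]
  refine Finset.sum_congr rfl fun J _ => ?_
  rw [← hg' J]
  exact DirectSum.toModule_lof _ _ _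

end KoszulModule

/-! ### The grading of the Koszul complex. -/

section Grading

variable {n : ℕ} {A R : Type*} [CommRing A] [CommRing R] [Algebra A R]
  (𝓡 : ℤ → Submodule A R) (δ : Fin n → ℕ)

/-- The grading of the Koszul complex: the basis element at `J` has degree `∑ j ∈ J, δ j`. -/
def koszulGrading (m : ℕ) (k : ℤ) :
    AddSubgroup (koszulChains (MvPolynomial (Fin n) A) (EnvPoly n R) n m) where
  carrier := {f | ∀ J, f.1 J ∈ EnvPoly.grading 𝓡 δ (k - ∑ j ∈ J, (δ j : ℤ))}
  zero_mem' _ := zero_mem _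
  add_mem' hf hg J := add_mem (hf J) (hg J)
  neg_mem' hf J := neg_mem (hf J)

variable {𝓡 δ}

theorem koszulSingle_mem_koszulGrading {m : ℕ} {k : ℤ} {J : Finset (Fin n)} (hJ : J.card = m)
    {b : EnvPoly n R} (hb : b ∈ EnvPoly.grading 𝓡 δ (k - ∑ j ∈ J, (δ j : ℤ))) :
    koszulSingle (MvPolynomial (Fin n) A) J hJ b ∈ koszulGrading 𝓡 δ m k := by
  intro J'
  rw [koszulSingle_apply]
  split_ifs with h
  · exact h ▸ hb
  · exact zero_mem _

variable [GradedAlgebra 𝓡]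

theorem isGradedModule_koszulGrading (m : ℕ) :
    IsGradedModule (polyGrading A δ) (koszulGrading (n := n) 𝓡 δ m) where
  smul_mem i j s f hs hf J := by
    have := smul_mem_grading hs (hf J)
    rw [← add_sub_assoc] at this
    exact this
  isInternal := by
    have h := EnvPoly.isInternal_grading (n := n) 𝓡 δ
    refine isInternal_of_projections
      (fun k f => ⟨fun J => gradedComponent h (k - ∑ j ∈ J, (δ j : ℤ)) (f.1 J), fun J hJ =>
        (congrArg _ (f.2 J hJ)).trans (map_zero _)⟩)
      (fun k f g => Subtype.ext (funext fun J => ?_))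
      (fun k f hf => Subtype.ext (funext fun J => ?_))
      (fun k l hl f hf => Subtype.ext (funext fun J => ?_)) (fun f => ?_)
    · exact map_add _ _ _
    · exact gradedComponent_of_mem _ (hf J)
    · exact gradedComponent_of_mem_ne _ (by omega) (hf J)
    · rw [koszulChains_eq_sum f]
      refine sum_mem fun J _ => ?_
      induction f.1 J.1 using homogeneous_induction h with
      | zero => rw [map_zero]; exact zero_mem _
      | add x y hx hy => rw [map_add]; exact add_mem hx hy
      | mem l x hx =>
        refine AddSubgroup.mem_iSup_of_mem (l + ∑ j ∈ J.1, (δ j : ℤ))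
          (koszulSingle_mem_koszulGrading J.2 ?_)
        rw [add_sub_cancel_right]
        exact hx

/-- Removing `j` from the index set lowers the degree by `δ j`, and the factor `t j` restores it. -/
theorem koszulMap_mem_koszulGrading {t : Fin n → EnvPoly n R}
    (ht : ∀ i, t i ∈ EnvPoly.grading 𝓡 δ (δ i)) {m : ℕ} {k : ℤ}
    {f : koszulChains (MvPolynomial (Fin n) A) (EnvPoly n R) n (m + 1)}
    (hf : f ∈ koszulGrading 𝓡 δ (m + 1) k) :
    koszulMap (MvPolynomial (Fin n) A) t m f ∈ koszulGrading 𝓡 δ m k := by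
  intro J
  rw [koszulMap_apply, koszulD_apply]
  refine sum_mem fun j hj => ?_
  rw [← zsmul_eq_mul]
  refine zsmul_mem ?_ _
  have h := mul_mem_grading (ht j) (hf (insert j J))
  rw [Finset.sum_insert (Finset.mem_compl.1 hj)] at h
  have e : (δ j : ℤ) + (k - (δ j + ∑ j ∈ J, (δ j : ℤ))) = k - ∑ j ∈ J, (δ j : ℤ) := by ring
  rwa [e] at h

end Grading

section Resolution

variable (n : ℕ) (A : Type u) {R : Type u} [CommRing A] [CommRing R] [Algebra A R]
  [Algebra (MvPolynomial (Fin n) A) R] [IsScalarTower A (MvPolynomial (Fin n) A) R]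

/-- The terms of the Koszul resolution of `R`. -/
abbrev koszulX (R : Type u) [CommRing R] [Algebra A R] (m : ℕ) :
    ModuleCat.{u} (MvPolynomial (Fin n) A) :=
  ModuleCat.of (MvPolynomial (Fin n) A)
    (koszulChains (MvPolynomial (Fin n) A) (EnvPoly n R) n m)

/-- The differentials of the Koszul resolution of `R`. -/
abbrev koszulXMap (R : Type u) [CommRing R] [Algebra A R] [Algebra (MvPolynomial (Fin n) A) R]
    [IsScalarTower A (MvPolynomial (Fin n) A) R] (m : ℕ) :
    koszulX n A R (m + 1) ⟶ koszulX n A R m :=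
  ModuleCat.ofHom (koszulMap (MvPolynomial (Fin n) A) (diagonalElement n A R) m)

theorem koszulXMap_comp (m : ℕ) : koszulXMap n A R (m + 1) ≫ koszulXMap n A R m = 0 := by
  refine ModuleCat.hom_ext (LinearMap.ext fun f => Subtype.ext ?_)
  exact koszulD_koszulD (diagonalElement n A R) f.1

/-- The augmentation of the Koszul resolution of `R`. -/
abbrev koszulAugmentation (R : Type u) [CommRing R] [Algebra A R]
    [Algebra (MvPolynomial (Fin n) A) R] [IsScalarTower A (MvPolynomial (Fin n) A) R] :
    koszulX n A R 0 ⟶ ModuleCat.of (MvPolynomial (Fin n) A) R :=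
  ModuleCat.ofHom (augmentation n A R ∘ₗ LinearMap.proj ∅ ∘ₗ Submodule.subtype _)

theorem koszulXMap_comp_augmentation :
    koszulXMap n A R 0 ≫ koszulAugmentation n A R = 0 := by
  ext f
  change augmentation n A R (koszulD (diagonalElement n A R) f.1 ∅) = 0
  rw [koszulD_apply, map_sum]
  refine Finset.sum_eq_zero fun i _ => ?_
  rw [augmentation_mul, augmentation_mul, augmentation_diagonalElement, zero_mul, mul_zero]

variable {n A} in
theorem exists_koszulXMap_eq (x : koszulX n A R 0) (hx : (koszulAugmentation n A R).hom x = 0) :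
    ∃ y, (koszulXMap n A R 0).hom y = x := by
  obtain ⟨c, hc⟩ := exists_eq_sum_of_augmentation_eq_zero (p := x.1 ∅) hx
  -- A `0`-chain in the kernel has value `∑ tᵢ cᵢ` at `∅`; it is the boundary of the `1`-chain with
  -- value `cᵢ` at `{i}`.
  refine ⟨∑ i, koszulSingle _ {i} (Finset.card_singleton i) (c i),
    Subtype.ext (funext fun J => ?_)⟩
  rw [map_sum]
  by_cases hJ : J = ∅
  · subst hJ
    rw [← hc]
    refine (map_sum (LinearMap.proj ∅ ∘ₗ Submodule.subtype
      (koszulChains (MvPolynomial (Fin n) A) (EnvPoly n R) n 0)) _ _).trans ?_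
    exact Finset.sum_congr rfl fun i _ => koszulD_koszulSingle_singleton
      (S := MvPolynomial (Fin n) A) (diagonalElement n A R) i (c i)
  · have : J.card ≠ 0 := by simpa using hJ
    rw [x.2 J this]
    exact Subtype.prop (_ : koszulChains (MvPolynomial (Fin n) A) (EnvPoly n R) n 0) J this

/-- The Koszul resolution of `R`. -/
def koszulResolution [Module.Projective (MvPolynomial (Fin n) A) (EnvPoly n R)] :
    ProjectiveResolution (ModuleCat.of (MvPolynomial (Fin n) A) R) where
  complex := ChainComplex.of (koszulX n A R) (koszulXMap n A R) (koszulXMap_comp n A)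
  projective m :=
    have := projective_koszulChains (S := MvPolynomial (Fin n) A) (B := EnvPoly n R) (n := n) m
    ModuleCat.projective_of_categoryTheory_projective
      (ModuleCat.of _ (koszulChains (MvPolynomial (Fin n) A) (EnvPoly n R) n m))
  π := augmentComplex _ _ _ (koszulAugmentation n A R) (koszulXMap_comp_augmentation n A)
  quasiIso := quasiIso_augmentComplex _ _ _ _ _
    (fun m (x : koszulChains (MvPolynomial (Fin n) A) (EnvPoly n R) n (m + 1)) hx => by
      let r : Fin n → R := fun i => algebraMap (MvPolynomial (Fin n) A) R (MvPolynomial.X i)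
      have hx' : koszulD (diagonalElement n A R) x.1 = 0 := congrArg Subtype.val hx
      obtain ⟨g, hg, h⟩ := koszul_exact (S := MvPolynomial (Fin n) A) (diagonalElement n A R)
        (koszulDiv r) (koszulDiv_mul_self r) (koszulDiv_mul_of_ne r) x.2 hx'
      exact ⟨⟨g, hg⟩, Subtype.ext h⟩)
    exists_koszulXMap_eq
    (fun r => by
      obtain ⟨b, hb⟩ := augmentation_surjective (n := n) (A := A) r
      refine ⟨koszulSingle (MvPolynomial (Fin n) A) ∅ Finset.card_empty b, ?_⟩
      refine Eq.trans (congrArg (augmentation n A R) ?_) hb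
      rw [LinearMap.comp_apply, LinearMap.proj_apply, Submodule.subtype_apply, koszulSingle_apply,
        if_pos rfl])

end Resolution

/-! ### Comparison of graded projective resolutions -/

section Comparison

variable {S : Type u} [CommRing S] {𝒮 : ℤ → AddSubgroup S}

theorem linearMap_ext_of_homogeneous {M N : Type*} [AddCommGroup M] [Module S M] [AddCommGroup N]
    [Module S N] {𝓜 : ℤ → AddSubgroup M} (h : DirectSum.IsInternal 𝓜) {f g : M →ₗ[S] N}
    (hfg : ∀ k, ∀ x ∈ 𝓜 k, f x = g x) : f = g := by
  ext x
  induction x using homogeneous_induction h with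
  | zero => rw [map_zero, map_zero]
  | add x y hx hy => rw [map_add, map_add, hx, hy]
  | mem k x hx => exact hfg k x hx

variable {M : ModuleCat.{u} S} {𝓜 : ℤ → AddSubgroup M}

/-- The identity of a graded module lifts to a homogeneous map between two graded projective
resolutions. -/
theorem exists_homogeneous_hom (h𝒮 : DirectSum.IsInternal 𝒮) (h𝓜 : DirectSum.IsInternal 𝓜)
    (Q P : GradedProjectiveResolution 𝒮 M 𝓜) :
    ∃ φ : ProjectiveResolution.Hom Q.res P.res (𝟙 M), ∀ i k, ∀ x ∈ Q.grading i k,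
      (φ.hom.f i).hom x ∈ P.grading i k := by
  -- Projectivity gives some lift `ψ`. Its degree `0` parts still commute with the differentials and
  -- augmentations, because those preserve degrees and hence commute with taking components.
  let ψ := ProjectiveResolution.lift (𝟙 M) Q.res P.res
  let g (i : ℕ) : Q.res.complex.X i ⟶ P.res.complex.X i :=
    ModuleCat.ofHom (degreeZeroPart h𝒮 (Q.isGraded i) (P.isGraded i) (ψ.f i).hom)
  have hg : ∀ i k, ∀ x ∈ Q.grading i k, (g i).hom x =
      gradedComponent (P.isGraded i).isInternal k ((ψ.f i).hom x) := fun i k x hx =>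
    degreeZeroPart_of_mem h𝒮 (Q.isGraded i) (P.isGraded i) (ψ.f i).hom hx
  refine ⟨⟨⟨g, fun i j _ => ?_⟩, ?_⟩, fun i k x hx =>
    degreeZeroPart_mem h𝒮 (Q.isGraded i) (P.isGraded i) (ψ.f i).hom hx⟩
  · refine ModuleCat.hom_ext (linearMap_ext_of_homogeneous (Q.isGraded i).isInternal
      fun k x hx => ?_)
    have h1 : (P.res.complex.d i j).hom ((ψ.f i).hom x) =
        (ψ.f j).hom ((Q.res.complex.d i j).hom x) :=
      congrArg (fun f => f.hom x) (ψ.comm i j)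
    change (P.res.complex.d i j).hom ((g i).hom x) = (g j).hom ((Q.res.complex.d i j).hom x)
    rw [hg _ _ _ hx, hg _ _ _ (Q.d_mem i j k x hx), ← h1]
    exact (gradedComponent_map (P.isGraded i).isInternal (P.isGraded j).isInternal
      (P.res.complex.d i j).hom.toAddMonoidHom (P.d_mem i j) k _).symm
  · let ι := (HomologicalComplex.singleObjXSelf (ComplexShape.down ℕ) 0 M).hom
    have hψ : (ψ.f 0 ≫ P.res.π.f 0) = Q.res.π.f 0 := by
      have := ProjectiveResolution.lift_commutes_zero (𝟙 M) Q.res P.res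
      rw [this]
      exact Category.comp_id _
    have h2 : ((ChainComplex.single₀ (ModuleCat.{u} S)).map (𝟙 M)).f 0 = 𝟙 _ := by
      rw [CategoryTheory.Functor.map_id]; rfl
    rw [h2, Category.comp_id, ← cancel_mono ι]
    refine ModuleCat.hom_ext (linearMap_ext_of_homogeneous (Q.isGraded 0).isInternal
      fun k x hx => ?_)
    change (P.res.π.f 0 ≫ ι).hom ((g 0).hom x) = (Q.res.π.f 0 ≫ ι).hom x
    rw [hg _ _ _ hx]
    refine (gradedComponent_map (P.isGraded 0).isInternal h𝓜
      (P.res.π.f 0 ≫ ι).hom.toAddMonoidHom P.augmentation_mem k _).symm.trans ?_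
    have h1 : (P.res.π.f 0 ≫ ι).hom ((ψ.f 0).hom x) = (Q.res.π.f 0 ≫ ι).hom x := by
      rw [← hψ]; rfl
    refine (congrArg _ h1).trans ?_
    exact gradedComponent_of_mem h𝓜 (Q.augmentation_mem k x hx)

/-- The homogeneous elements of `Ext` can be computed by any graded projective resolution. -/
theorem mem_extGrading_iff (h𝒮 : DirectSum.IsInternal 𝒮) (h𝓜 : DirectSum.IsInternal 𝓜)
    (Q : GradedProjectiveResolution 𝒮 M 𝓜) {N : ModuleCat.{u} S} (𝓝 : ℤ → AddSubgroup N)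
    (i : ℕ) (ν : ℤ) (x : Abelian.Ext.{u} M N i) :
    x ∈ extGrading 𝒮 𝓜 𝓝 i ν ↔ ∃ (f : Q.res.complex.X i ⟶ N)
      (hf : Q.res.complex.d (i + 1) i ≫ f = 0),
      (∀ (k : ℤ) (y : Q.res.complex.X i), y ∈ Q.grading i k → f.hom y ∈ 𝓝 (k + ν)) ∧
      Q.res.extMk f (i + 1) rfl hf = x := by
  constructor
  · rintro ⟨P, f, hf, hfν, rfl⟩
    obtain ⟨φ, hφ⟩ := exists_homogeneous_hom h𝒮 h𝓜 Q P
    refine ⟨φ.hom.f i ≫ f, by rw [← φ.hom.comm_assoc, hf, Limits.comp_zero],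
      fun k y hy => hfν k _ (hφ i k y hy), ?_⟩
    rw [← ProjectiveResolution.mk₀_comp_extMk f (i + 1) rfl hf φ, Abelian.Ext.mk₀_id_comp]
  · rintro ⟨f, hf, h⟩
    exact ⟨Q, f, hf, h⟩

theorem smul_extMk {M N : ModuleCat.{u} S} (P : ProjectiveResolution M) {i : ℕ} (s : S)
    (f : P.complex.X i ⟶ N) (hf : P.complex.d (i + 1) i ≫ f = 0) :
    s • P.extMk f (i + 1) rfl hf =
      P.extMk (s • f) (i + 1) rfl (by rw [Linear.comp_smul, hf, smul_zero]) := by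
  rw [Abelian.Ext.smul_eq_comp_mk₀, ProjectiveResolution.extMk_comp_mk₀]
  congr 1

end Comparison

/-! ### The Koszul complex as a graded projective resolution. -/

section KoszulGraded

variable {n : ℕ} {A : Type u} {R : Type u} [CommRing A] [CommRing R] [Algebra A R]
  [Algebra (MvPolynomial (Fin n) A) R] [IsScalarTower A (MvPolynomial (Fin n) A) R]
  [Module.Projective (MvPolynomial (Fin n) A) (EnvPoly n R)]
  (𝓡 : ℤ → Submodule A R) [GradedAlgebra 𝓡] (δ : Fin n → ℕ)
  (hgraded : ∀ (k : ℤ) (s : MvPolynomial (Fin n) A), s ∈ polyGrading A δ k →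
      algebraMap (MvPolynomial (Fin n) A) R s ∈ 𝓡 k)

theorem X_mem_polyGrading (i : Fin n) :
    (MvPolynomial.X i : MvPolynomial (Fin n) A) ∈ polyGrading A δ (δ i) :=
  MvPolynomial.isWeightedHomogeneous_X A (fun i => (δ i : ℤ)) i

/-- The Koszul resolution of `R`, with its grading. -/
def koszulGradedResolution : GradedProjectiveResolution (polyGrading A δ)
    (ModuleCat.of (MvPolynomial (Fin n) A) R) (fun k => (𝓡 k).toAddSubgroup) where
  res := koszulResolution n A
  grading m := koszulGrading 𝓡 δ m
  isGraded m := isGradedModule_koszulGrading m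
  d_mem i j k x hx := by
    by_cases h : i = j + 1
    · subst h
      have e : (koszulResolution (R := R) n A).complex.d (j + 1) j = koszulXMap n A R j :=
        chainComplex_of_d _ _ (koszulXMap_comp n A) j
      rw [e]
      exact koszulMap_mem_koszulGrading
        (fun i => koszulElement_mem_grading (hgraded _ _ (X_mem_polyGrading δ i))) hx
    · have e : (koszulResolution (R := R) n A).complex.d i j = 0 :=
        ChainComplex.of_d_ne _ _ h
      rw [e]
      exact zero_mem _
  augmentation_mem k x hx := by
    have e : (koszulResolution (R := R) n A).π.f 0 = koszulAugmentation n A R :=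
      augmentComplex_f_zero _ _ (koszulXMap_comp n A) _ (koszulXMap_comp_augmentation n A)
    have e' : (HomologicalComplex.singleObjXSelf (ComplexShape.down ℕ) 0
        (ModuleCat.of (MvPolynomial (Fin n) A) R)).hom = 𝟙 _ := by
      rw [ChainComplex.single₀ObjXSelf]; rfl
    rw [e, e']
    have h := hx ∅
    rw [Finset.sum_empty, sub_zero] at h
    exact EnvPoly.augmentation_mem hgraded h

end KoszulGraded

/-! ### The computation of `Extⁿ(R, A[x₁,…,xₙ])` -/

section TopDegree

variable {n : ℕ}

theorem subsingleton_koszulChains_of_lt {S B : Type*} [CommRing S] [CommRing B] [Algebra S B]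
    {m : ℕ} (hm : n < m) : Subsingleton (koszulChains S B n m) := by
  refine ⟨fun f g => Subtype.ext (funext fun J => ?_)⟩
  have h : J.card ≠ m := fun h => by
    have := Finset.card_le_univ J
    rw [Fintype.card_fin] at this
    omega
  rw [f.2 J h, g.2 J h]

theorem card_eq_iff_eq_univ (J : Finset (Fin n)) : J.card = n ↔ J = Finset.univ := by
  rw [← Finset.card_eq_iff_eq_univ, Fintype.card_fin]

theorem koszulChains_eq_single {S B : Type*} [CommRing S] [CommRing B] [Algebra S B]
    (f : koszulChains S B n n) :
    f = koszulSingle S Finset.univ (Finset.card_fin n) (f.1 Finset.univ) := by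
  refine Subtype.ext (funext fun J => ?_)
  rw [koszulSingle_apply]
  split_ifs with h
  · rw [h]
  · exact f.2 J (fun h' => h ((card_eq_iff_eq_univ J).1 h'))

/-- The complement of `J` is a single index. The factor in front of `f univ` lies in the ideal
generated by `t`, which is why top coboundaries do too. -/
theorem koszulD_apply_of_card {B : Type*} [CommRing B] (t : Fin (n + 1) → B)
    (f : Finset (Fin (n + 1)) → B) {J : Finset (Fin (n + 1))} (hJ : J.card = n) :
    koszulD t f J = (∑ j ∈ Jᶜ, (koszulSign j J : B) * t j) * f Finset.univ := by
  rw [koszulD_apply, Finset.sum_mul]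
  refine Finset.sum_congr rfl fun j hj => ?_
  have : insert j J = Finset.univ := by
    rw [← card_eq_iff_eq_univ, Finset.card_insert_of_notMem (Finset.mem_compl.1 hj), hJ]
  rw [this, mul_assoc]

theorem koszulD_apply_erase {B : Type*} [CommRing B] (t : Fin n → B)
    (f : Finset (Fin n) → B) (i : Fin n) :
    koszulD t f (Finset.univ.erase i) =
      (koszulSign i (Finset.univ.erase i) : B) * (t i * f Finset.univ) := by
  have h : (Finset.univ.erase i)ᶜ = {i} := by ext; simp
  rw [koszulD_apply, h, Finset.sum_singleton, Finset.insert_erase (Finset.mem_univ i)]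

end TopDegree

section ExtComputation

variable {n : ℕ} {A : Type u} {R : Type u} [CommRing A] [CommRing R] [Algebra A R]
  [Algebra (MvPolynomial (Fin n) A) R] [IsScalarTower A (MvPolynomial (Fin n) A) R]
  [Module.Projective (MvPolynomial (Fin n) A) (EnvPoly n R)]
  (ρ : R →ₗ[A] A)

/-- The `n`-cochain of the Koszul resolution given by the functional `traceMul ρ p`. -/
def traceCochain (p : EnvPoly n R) :
    (koszulResolution (R := R) n A).complex.X n ⟶
      ModuleCat.of (MvPolynomial (Fin n) A) (MvPolynomial (Fin n) A) :=
  ModuleCat.ofHom (traceMul ρ p ∘ₗ LinearMap.proj Finset.univ ∘ₗ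
    Submodule.subtype (koszulChains (MvPolynomial (Fin n) A) (EnvPoly n R) n n))

theorem traceCochain_apply (p : EnvPoly n R)
    (f : koszulChains (MvPolynomial (Fin n) A) (EnvPoly n R) n n) :
    (traceCochain ρ p).hom f = trace ρ (p * f.1 Finset.univ) := rfl

/-- `Fin n` has no subset with `n + 1` elements, so every top cochain is a cocycle. -/
theorem koszulResolution_d_comp {N : ModuleCat.{u} (MvPolynomial (Fin n) A)}
    (f : (koszulResolution (R := R) n A).complex.X n ⟶ N) :
    (koszulResolution (R := R) n A).complex.d (n + 1) n ≫ f = 0 := by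
  have : Subsingleton ((koszulResolution (R := R) n A).complex.X (n + 1)) :=
    subsingleton_koszulChains_of_lt (S := MvPolynomial (Fin n) A) (B := EnvPoly n R)
      (Nat.lt_succ_self n)
  refine ModuleCat.hom_ext (LinearMap.ext fun x => ?_)
  rw [Subsingleton.elim x 0, map_zero, map_zero]

/-- The map `A[x₁,…,xₙ] ⊗ R → Extⁿ(R, A[x₁,…,xₙ])` that sends `p` to the class of the cocycle
given by the functional `traceMul ρ p`. -/
def extClass : EnvPoly n R →ₗ[MvPolynomial (Fin n) A]
    Abelian.Ext.{u} (ModuleCat.of (MvPolynomial (Fin n) A) R)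
      (ModuleCat.of (MvPolynomial (Fin n) A) (MvPolynomial (Fin n) A)) n where
  toFun p := (koszulResolution n A).extMk (traceCochain ρ p) (n + 1) rfl
    (koszulResolution_d_comp _)
  map_add' p q := by
    rw [ProjectiveResolution.add_extMk]
    congr 1
    refine ModuleCat.hom_ext (LinearMap.ext fun f => ?_)
    change trace ρ ((p + q) * f.1 Finset.univ) =
      trace ρ (p * f.1 Finset.univ) + trace ρ (q * f.1 Finset.univ)
    rw [add_mul, map_add]
  map_smul' s p := by
    rw [RingHom.id_apply, smul_extMk]
    congr 1
    refine ModuleCat.hom_ext (LinearMap.ext fun f => ?_)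
    change trace ρ ((s • p) * f.1 Finset.univ) = s • trace ρ (p * f.1 Finset.univ)
    rw [smul_mul_assoc, map_smul]

theorem extClass_apply (p : EnvPoly n R) : extClass ρ p =
    (koszulResolution n A).extMk (traceCochain ρ p) (n + 1) rfl (koszulResolution_d_comp _) := rfl

variable {ρ} (hρ : ((LinearMap.mul A R).compr₂ ρ).IsPerfPair)

include hρ

theorem exists_traceCochain_eq [Module.Finite A R]
    (f : (koszulResolution (R := R) n A).complex.X n ⟶
      ModuleCat.of (MvPolynomial (Fin n) A) (MvPolynomial (Fin n) A)) :
    ∃ p, traceCochain ρ p = f := by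
  let f' : koszulChains (MvPolynomial (Fin n) A) (EnvPoly n R) n n →ₗ[MvPolynomial (Fin n) A]
    MvPolynomial (Fin n) A := f.hom
  obtain ⟨p, hp⟩ := exists_traceMul_eq hρ
    (f' ∘ₗ koszulSingle (MvPolynomial (Fin n) A) Finset.univ (Finset.card_fin n))
  refine ⟨p, ModuleCat.hom_ext (LinearMap.ext fun x => ?_)⟩
  refine (LinearMap.congr_fun hp (x.1 Finset.univ)).trans ?_
  exact congrArg f' (koszulChains_eq_single x).symm

theorem extClass_surjective [Module.Finite A R] :
    Function.Surjective (extClass (n := n) ρ) := by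
  intro x
  obtain ⟨f, hf, rfl⟩ := (koszulResolution (R := R) n A).extMk_surjective x (n + 1) rfl
  obtain ⟨p, rfl⟩ := exists_traceCochain_eq hρ f
  exact ⟨p, rfl⟩

/-- Self-duality of the Koszul complex in top degree: under `traceMul` the coboundaries correspond
to the ideal generated by the `tᵢ`, which is the kernel of the augmentation. -/
theorem extClass_eq_zero_iff [Module.Finite A R] (hn : n = 0 → Subsingleton R) (p : EnvPoly n R) :
    extClass ρ p = 0 ↔ augmentation n A R p = 0 := by
  cases n with
  -- There are no cochains of degree `n - 1` to bound with; the hypothesis leaves only `R = 0`.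
  | zero =>
    have := hn rfl
    have h : p = 0 := by ext α; exact Subsingleton.elim _ _
    rw [h, map_zero, map_zero]
    simp
  | succ m =>
    have e : (koszulResolution (R := R) (m + 1) A).complex.d (m + 1) m = koszulXMap (m + 1) A R m :=
      chainComplex_of_d _ _ (koszulXMap_comp (m + 1) A) m
    rw [extClass_apply, ProjectiveResolution.extMk_eq_zero_iff _ _ _ _ _ m rfl, e]
    constructor
    · rintro ⟨g, hg⟩
      let g' : koszulChains (MvPolynomial (Fin (m + 1)) A) (EnvPoly (m + 1) R) (m + 1) m
        →ₗ[MvPolynomial (Fin (m + 1)) A] MvPolynomial (Fin (m + 1)) A := g.hom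
      -- Each component of the bounding cochain is a trace functional with representative `c J`, so
      -- `p` is the combination of the `c J` with coefficients in the ideal generated by `t`.
      choose c hc using fun J : {J : Finset (Fin (m + 1)) // J.card = m} =>
        exists_traceMul_eq hρ (g' ∘ₗ koszulSingle (MvPolynomial (Fin (m + 1)) A) J.1 J.2)
      let t := diagonalElement (m + 1) A R
      let w (J : Finset (Fin (m + 1))) : EnvPoly (m + 1) R :=
        ∑ j ∈ Jᶜ, (koszulSign j J : EnvPoly (m + 1) R) * t j
      have hp : p = ∑ J, c J * w J.1 := by
        rw [← sub_eq_zero]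
        refine eq_zero_of_traceMul hρ (LinearMap.ext fun b => ?_)
        let x := koszulSingle (MvPolynomial (Fin (m + 1)) A) Finset.univ (Finset.card_fin (m + 1)) b
        have hx : x.1 Finset.univ = b := by
          rw [koszulSingle_apply, if_pos rfl]
        have h1 : g' (koszulMap (MvPolynomial (Fin (m + 1)) A) t m x) = trace ρ (p * b) := by
          rw [← hx]
          exact congrArg (fun f => f.hom x) hg
        rw [koszulChains_eq_sum (koszulMap (MvPolynomial (Fin (m + 1)) A) t m x), map_sum] at h1
        rw [traceMul_apply, sub_mul, map_sub, ← h1, Finset.sum_mul, map_sum, LinearMap.zero_apply,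
          sub_eq_zero]
        refine Finset.sum_congr rfl fun J _ => ?_
        have h2 := LinearMap.congr_fun (hc J)
          ((koszulMap (MvPolynomial (Fin (m + 1)) A) t m x).1 J.1)
        refine h2.symm.trans ?_
        rw [traceMul_apply, koszulMap_apply, koszulD_apply_of_card _ _ J.2, hx, mul_assoc]
      rw [hp, map_sum]
      refine Finset.sum_eq_zero fun J _ => ?_
      rw [augmentation_mul, map_sum, Finset.sum_eq_zero, mul_zero]
      intro j _
      rw [augmentation_mul, augmentation_diagonalElement, mul_zero]
    · intro hp
      obtain ⟨c, rfl⟩ := exists_eq_sum_of_augmentation_eq_zero hp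
      -- The sign put in front of `c i` cancels the one produced by the differential at `univ.erase
      -- i`.
      let g : koszulChains (MvPolynomial (Fin (m + 1)) A) (EnvPoly (m + 1) R) (m + 1) m
          →ₗ[MvPolynomial (Fin (m + 1)) A] MvPolynomial (Fin (m + 1)) A :=
        ∑ i, traceMul ρ ((koszulSign i (Finset.univ.erase i) : EnvPoly (m + 1) R) * c i) ∘ₗ
          LinearMap.proj (Finset.univ.erase i) ∘ₗ Submodule.subtype _
      refine ⟨ModuleCat.ofHom g, ModuleCat.hom_ext (LinearMap.ext fun
        (x : koszulChains (MvPolynomial (Fin (m + 1)) A) (EnvPoly (m + 1) R) (m + 1) (m + 1)) =>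
          ?_)⟩
      change g (koszulMap (MvPolynomial (Fin (m + 1)) A) (diagonalElement (m + 1) A R) m x) =
        trace ρ ((∑ i, diagonalElement (m + 1) A R i * c i) * x.1 Finset.univ)
      rw [LinearMap.sum_apply, Finset.sum_mul, map_sum]
      refine Finset.sum_congr rfl fun i _ => ?_
      rw [LinearMap.comp_apply, LinearMap.comp_apply, LinearMap.proj_apply, Submodule.subtype_apply,
        koszulMap_apply, koszulD_apply_erase, traceMul_apply]
      congr 1
      have := congrArg (Int.cast (R := EnvPoly (m + 1) R))
        (koszulSign_mul_self i (Finset.univ.erase i))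
      push_cast at this
      linear_combination (c i * diagonalElement (m + 1) A R i * x.1 Finset.univ) * this

/-- `Extⁿ(R, A[x₁,…,xₙ]) ≅ R` for a finite `A`-algebra `R` with a perfect pairing. -/
def extEquiv [Module.Finite A R] (hn : n = 0 → Subsingleton R) :
    Abelian.Ext.{u} (ModuleCat.of (MvPolynomial (Fin n) A) R)
      (ModuleCat.of (MvPolynomial (Fin n) A) (MvPolynomial (Fin n) A)) n
        ≃ₗ[MvPolynomial (Fin n) A] R :=
  ((extClass (n := n) ρ).quotKerEquivOfSurjective (extClass_surjective hρ)).symm ≪≫ₗ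
    Submodule.quotEquivOfEq (extClass ρ).ker (augmentation n A R).ker
      (Submodule.ext fun p => extClass_eq_zero_iff hρ hn p) ≪≫ₗ
    (augmentation n A R).quotKerEquivOfSurjective augmentation_surjective

theorem extEquiv_extClass [Module.Finite A R] (hn : n = 0 → Subsingleton R) (p : EnvPoly n R) :
    extEquiv hρ hn (extClass ρ p) = augmentation n A R p := by
  have h : ((extClass (n := n) ρ).quotKerEquivOfSurjective (extClass_surjective hρ)).symm
      (extClass ρ p) = Submodule.Quotient.mk p := by
    rw [LinearEquiv.symm_apply_eq]
    rfl
  simp only [extEquiv, LinearEquiv.trans_apply, h]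
  rfl

variable {𝓡 : ℤ → Submodule A R} [GradedAlgebra 𝓡] {δ : Fin n → ℕ} {d : ℕ}
  (hρd : ∀ k : ℤ, k ≠ d → ∀ r ∈ 𝓡 k, ρ r = 0)

-- Multiplication by `b` has degree `l` and the trace has degree `-d`.
omit [Algebra (MvPolynomial (Fin n) A) R] [IsScalarTower A (MvPolynomial (Fin n) A) R] hρ
  [Module.Projective (MvPolynomial (Fin n) A) (EnvPoly n R)] in
include hρd in
theorem gradedComponent_trace_mul {l : ℤ} {b : EnvPoly n R} (hb : b ∈ EnvPoly.grading 𝓡 δ l)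
    (k : ℤ) (p : EnvPoly n R) :
    gradedComponent (isInternal_polyGrading (A := A) (δ := δ)) (k + l - d) (trace ρ (p * b)) =
      trace ρ (gradedComponent (EnvPoly.isInternal_grading 𝓡 δ) k p * b) := by
  induction p using homogeneous_induction (EnvPoly.isInternal_grading 𝓡 δ) with
  | zero => simp
  | add x y hx hy => simp only [add_mul, map_add, hx, hy]
  | mem j x hx =>
    have h := trace_mem_polyGrading hρd (mul_mem_grading hx hb)
    by_cases hj : j = k
    · subst hj
      rw [gradedComponent_of_mem _ hx, gradedComponent_of_mem _ h]
    · rw [gradedComponent_of_mem_ne _ hj hx, gradedComponent_of_mem_ne _ (by omega) h, zero_mul,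
        map_zero]

-- The top Koszul generator sits in degree `∑ δᵢ` and the target is twisted by `-∑ δᵢ`; these
-- cancel, so only the degree `-d` of the trace counts, and the cochain of `p` has degree `ν`
-- exactly when `p` has degree `d + ν`.
include hρd in
theorem mem_extGrading_iff_extEquiv_mem [Module.Finite A R] (hn : n = 0 → Subsingleton R)
    (hgraded : ∀ (k : ℤ) (s : MvPolynomial (Fin n) A), s ∈ polyGrading A δ k →
      algebraMap (MvPolynomial (Fin n) A) R s ∈ 𝓡 k) (ν : ℤ)
    (x : Abelian.Ext.{u} (ModuleCat.of (MvPolynomial (Fin n) A) R)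
      (ModuleCat.of (MvPolynomial (Fin n) A) (MvPolynomial (Fin n) A)) n) :
    x ∈ extGrading (polyGrading A δ) (M := ModuleCat.of (MvPolynomial (Fin n) A) R)
      (N := ModuleCat.of (MvPolynomial (Fin n) A) (MvPolynomial (Fin n) A))
      (fun k => (𝓡 k).toAddSubgroup) (shift (polyGrading A δ) (-∑ i, (δ i : ℤ))) n ν ↔
    extEquiv hρ hn x ∈ 𝓡 (d + ν) := by
  rw [mem_extGrading_iff isInternal_polyGrading isInternal_toAddSubgroup
    (koszulGradedResolution 𝓡 δ hgraded)]
  constructor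
  · rintro ⟨f, hf, hfν, rfl⟩
    obtain ⟨p, rfl⟩ := exists_traceCochain_eq hρ f
    have h𝓑 := EnvPoly.isInternal_grading (n := n) 𝓡 δ
    have h1 : ∀ l, ∀ b ∈ EnvPoly.grading 𝓡 δ l, trace ρ (p * b) ∈ polyGrading A δ (l + ν) := by
      intro l b hb
      have h2 := hfν (l + ∑ i, (δ i : ℤ))
        (koszulSingle (MvPolynomial (Fin n) A) Finset.univ (Finset.card_fin n) b)
        (koszulSingle_mem_koszulGrading _ (by rwa [add_sub_cancel_right]))
      have h3 : (traceCochain ρ p).hom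
          (koszulSingle (MvPolynomial (Fin n) A) Finset.univ (Finset.card_fin n) b) =
            trace ρ (p * b) := by
        rw [traceCochain_apply, koszulSingle_apply, if_pos rfl]
      have h4 : -∑ i, (δ i : ℤ) + (l + ∑ i, (δ i : ℤ) + ν) = l + ν := by ring
      rw [← h4, ← h3]
      exact h2
    -- Both sides define the same functional on homogeneous elements, since the trace of `p * b` is
    -- already concentrated in degree `l + ν`.
    have hp : p = gradedComponent h𝓑 (d + ν) p := by
      rw [← sub_eq_zero]
      refine eq_zero_of_traceMul hρ (linearMap_ext_of_homogeneous h𝓑 fun l b hb => ?_)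
      rw [traceMul_apply, sub_mul, map_sub, ← gradedComponent_trace_mul hρd hb,
        gradedComponent_of_mem, sub_self, LinearMap.zero_apply]
      have h4 : (d : ℤ) + ν + l - d = l + ν := by ring
      rw [h4]
      exact h1 l b hb
    have h5 : (koszulResolution n A).extMk (traceCochain ρ p) (n + 1) rfl hf = extClass ρ p := rfl
    have h6 := extEquiv_extClass hρ hn p
    rw [← h5] at h6
    refine (congrArg (· ∈ 𝓡 (d + ν)) h6).mpr ?_
    rw [hp]
    exact EnvPoly.augmentation_mem hgraded (gradedComponent_mem h𝓑 _ _)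
  · intro hx
    -- The constant polynomial is a homogeneous lift along the augmentation.
    have hp : (monomial 0 (extEquiv hρ hn x) : EnvPoly n R) ∈ EnvPoly.grading 𝓡 δ (d + ν) :=
      monomial_mem_grading (by rwa [map_zero, sub_zero])
    refine ⟨traceCochain ρ (monomial 0 (extEquiv hρ hn x)), koszulResolution_d_comp _,
      fun k y hy => ?_, ?_⟩
    · have h := trace_mem_polyGrading hρd (mul_mem_grading hp (hy Finset.univ))
      have h4 : (d : ℤ) + ν + (k - ∑ i, (δ i : ℤ)) - d = -∑ i, (δ i : ℤ) + (k + ν) := by ring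
      rw [h4] at h
      exact h
    · apply (extEquiv hρ hn).injective
      refine (extEquiv_extClass hρ hn _).trans ?_
      rw [augmentation_monomial]
      have : (MvPolynomial.monomial 0 1 : MvPolynomial (Fin n) A) = 1 := rfl
      rw [this, map_one, mul_one]

end ExtComputation

/-! ### The graded dual -/

section Dual

variable {n : ℕ} {A R : Type*} [CommRing A] [CommRing R] [Algebra A R]
  [Algebra (MvPolynomial (Fin n) A) R] [IsScalarTower A (MvPolynomial (Fin n) A) R]

variable (n) in
/-- The map `r ↦ ρ (r ·)` from `R` to its relative dual. -/
def toRelDual (ρ : R →ₗ[A] A) : R →ₗ[MvPolynomial (Fin n) A] RelDual A R where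
  toFun r := (LinearMap.mul A R).compr₂ ρ r
  map_add' r r' := map_add ((LinearMap.mul A R).compr₂ ρ) r r'
  map_smul' s r := LinearMap.ext fun r' => congrArg ρ (by
    change (s • r) * r' = r * s • r'
    rw [smul_mul_assoc, mul_smul_comm])

variable {ρ : R →ₗ[A] A} (hρ : ((LinearMap.mul A R).compr₂ ρ).IsPerfPair)

include hρ in
theorem toRelDual_bijective : Function.Bijective (toRelDual n ρ) := hρ.bijective_left

variable {𝓡 : ℤ → Submodule A R} [GradedAlgebra 𝓡] {d : ℕ}
  (hρd : ∀ k : ℤ, k ≠ d → ∀ r ∈ 𝓡 k, ρ r = 0)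

include hρd in
theorem toRelDual_mem_homogeneousFunctionals {ν : ℤ} {r : R} (hr : r ∈ 𝓡 (d + ν)) :
    toRelDual n ρ r ∈ homogeneousFunctionals A (fun k => (𝓡 k).toAddSubgroup) ν := by
  intro k hk m hm
  exact hρd _ (by omega) _ (SetLike.mul_mem_graded hr hm)

omit [Algebra (MvPolynomial (Fin n) A) R] [IsScalarTower A (MvPolynomial (Fin n) A) R] in
include hρd in
theorem apply_mul_eq_apply_component_mul {l : ℤ} {b : R} (hb : b ∈ 𝓡 l) (r : R) :
    ρ (r * b) = ρ (gradedComponent (isInternal_toAddSubgroup (𝓡 := 𝓡)) (d - l) r * b) := by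
  have h := isInternal_toAddSubgroup (𝓡 := 𝓡)
  induction r using homogeneous_induction h with
  | zero => simp
  | add x y hx hy => simp only [add_mul, map_add, hx, hy]
  | mem j x hx =>
    by_cases hj : j = d - l
    · rw [gradedComponent_of_mem h (hj ▸ hx)]
    · rw [gradedComponent_of_mem_ne h hj hx, zero_mul, map_zero]
      exact hρd _ (by omega) _ (SetLike.mul_mem_graded hx hb)

-- Against homogeneous elements, `r` and its component of degree `d + ν` pair equally: in degree
-- `-ν` no other component contributes, and in other degrees both pairings vanish. Injectivity of
-- the pairing finishes.
include hρ hρd in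
theorem mem_of_toRelDual_mem_homogeneousFunctionals {ν : ℤ} {r : R}
    (hr : toRelDual n ρ r ∈ homogeneousFunctionals A (fun k => (𝓡 k).toAddSubgroup) ν) :
    r ∈ 𝓡 (d + ν) := by
  have h := isInternal_toAddSubgroup (𝓡 := 𝓡)
  have hmem : gradedComponent h (d + ν) r ∈ 𝓡 (d + ν) := gradedComponent_mem h _ r
  have : r = gradedComponent h (d + ν) r := by
    refine (toRelDual_bijective (n := n) hρ).1 (LinearMap.ext fun b => ?_)
    change ρ (r * b) = ρ (gradedComponent h (d + ν) r * b)
    induction b using homogeneous_induction h with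
    | zero => simp
    | add x y hx hy => simp only [mul_add, map_add, hx, hy]
    | mem l b hb =>
      by_cases hl : l = -ν
      · subst hl
        rw [apply_mul_eq_apply_component_mul hρd hb, sub_neg_eq_add]
      · rw [hρd _ (by omega) _ (SetLike.mul_mem_graded hmem hb)]
        exact hr l hl b hb
  rw [this]
  exact hmem

-- Each functional is `ρ (r ·)`, and the homogeneous parts of `r` give homogeneous functionals.
include hρ hρd in
theorem gradedDual_eq_top :
    gradedDual A (MvPolynomial (Fin n) A) (fun k => (𝓡 k).toAddSubgroup) = ⊤ := by
  rw [eq_top_iff]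
  intro φ _
  obtain ⟨r, rfl⟩ := (toRelDual_bijective (n := n) hρ).2 φ
  induction r using homogeneous_induction (isInternal_toAddSubgroup (𝓡 := 𝓡)) with
  | zero => rw [map_zero]; exact zero_mem _
  | add x y hx hy => rw [map_add]; exact add_mem (hx trivial) (hy trivial)
  | mem k r hr =>
    refine Submodule.subset_span (Set.mem_iUnion.2 ⟨k - d,
      toRelDual_mem_homogeneousFunctionals hρd ?_⟩)
    rw [add_sub_cancel]
    exact hr

/-- The isomorphism `*Hom_A(R, A) ≅ R`. -/
def gradedDualEquiv : gradedDual A (MvPolynomial (Fin n) A) (fun k => (𝓡 k).toAddSubgroup)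
    ≃ₗ[MvPolynomial (Fin n) A] R :=
  LinearEquiv.ofTop _ (gradedDual_eq_top hρ hρd) ≪≫ₗ
    (LinearEquiv.ofBijective (toRelDual n ρ) (toRelDual_bijective hρ)).symm

theorem mem_gradedDualGrading_iff (ν : ℤ)
    (φ : gradedDual A (MvPolynomial (Fin n) A) (fun k => (𝓡 k).toAddSubgroup)) :
    φ ∈ gradedDualGrading A (MvPolynomial (Fin n) A) (fun k => (𝓡 k).toAddSubgroup) ν ↔
      gradedDualEquiv hρ hρd φ ∈ 𝓡 (d + ν) := by
  have h : toRelDual n ρ (gradedDualEquiv hρ hρd φ) = φ.1 :=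
    (LinearEquiv.ofBijective (toRelDual n ρ) (toRelDual_bijective hρ)).apply_symm_apply φ.1
  change φ.1 ∈ homogeneousFunctionals A (fun k => (𝓡 k).toAddSubgroup) ν ↔ _
  rw [← h]
  exact ⟨mem_of_toRelDual_mem_homogeneousFunctionals hρ hρd,
    toRelDual_mem_homogeneousFunctionals hρd⟩

end Dual

/-! ### Macaulay's inverse system -/

section Macaulay

variable {n : ℕ} {A R : Type*} [CommRing A] [CommRing R] [Algebra A R]
  [Algebra (MvPolynomial (Fin n) A) R]

theorem coeff_contract (g G : MvPolynomial (Fin n) A) (γ : Fin n →₀ ℕ) :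
    (contract g G).coeff γ = ∑ α ∈ g.support, g.coeff α * G.coeff (α + γ) := by
  classical
  rw [contract, MvPolynomial.coeff_sum]
  refine Finset.sum_congr rfl fun α _ => ?_
  rw [MvPolynomial.coeff_sum, Finset.sum_eq_single (α + γ)]
  · rw [if_pos le_self_add, add_tsub_cancel_left, MvPolynomial.coeff_monomial, if_pos rfl]
  · intro β _ hβ
    split_ifs with h
    · rw [MvPolynomial.coeff_monomial, if_neg]
      rintro rfl
      exact hβ (add_tsub_cancel_of_le h).symm
    · rfl
  · intro h
    rw [MvPolynomial.notMem_support_iff.1 h, mul_zero]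
    simp

variable {δ : Fin n → ℕ} (hδ : ∀ i, 0 < δ i) {d : ℕ} {ρ : R →ₗ[A] A}
  {𝓡 : ℤ → Submodule A R}
  (hρd : ∀ k : ℤ, k ≠ d → ∀ r ∈ 𝓡 k, ρ r = 0)
  (hgraded : ∀ (k : ℤ) (s : MvPolynomial (Fin n) A), s ∈ polyGrading A δ k →
      algebraMap (MvPolynomial (Fin n) A) R s ∈ 𝓡 k)

-- Summing over the exponents of weight `d` loses nothing: `ρ` kills all other monomials.
include hρd hgraded in
theorem coeff_macaulayDualGenerator (β : Fin n →₀ ℕ) :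
    (macaulayDualGenerator δ hδ d ρ).coeff β =
      ρ (algebraMap (MvPolynomial (Fin n) A) R (MvPolynomial.monomial β 1)) := by
  classical
  simp only [macaulayDualGenerator, MvPolynomial.coeff_sum, MvPolynomial.coeff_monomial,
    Finset.sum_ite_eq', Set.Finite.mem_toFinset, Set.mem_ofPred_eq]
  split_ifs with h
  · rfl
  · refine (hρd (weight δ β) ?_ _ (hgraded _ _ ?_)).symm
    · intro e
      apply h
      have : weight δ β = ((Finsupp.weight δ β : ℕ) : ℤ) := by
        simp [weight, Finsupp.weight_apply, Finsupp.sum]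
      exact_mod_cast this.symm.trans e
    · refine mem_polyGrading.2 fun γ hγ => ?_
      rw [MvPolynomial.coeff_monomial] at hγ
      split_ifs at hγ with e
      · rw [e]
      · exact absurd rfl hγ

variable [IsScalarTower A (MvPolynomial (Fin n) A) R]

theorem algebraMap_smul_of_tower (a : A) (s : MvPolynomial (Fin n) A) :
    algebraMap (MvPolynomial (Fin n) A) R (a • s) = a • algebraMap (MvPolynomial (Fin n) A) R s :=
  map_smul (IsScalarTower.toAlgHom A (MvPolynomial (Fin n) A) R) a s

include hρd hgraded in
theorem coeff_contract_macaulayDualGenerator (g : MvPolynomial (Fin n) A) (γ : Fin n →₀ ℕ) :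
    (contract g (macaulayDualGenerator δ hδ d ρ)).coeff γ =
      ρ (algebraMap (MvPolynomial (Fin n) A) R g *
        algebraMap (MvPolynomial (Fin n) A) R (MvPolynomial.monomial γ 1)) := by
  rw [coeff_contract, ← map_mul]
  conv_rhs => rw [MvPolynomial.as_sum g, Finset.sum_mul, map_sum, map_sum]
  refine Finset.sum_congr rfl fun α _ => ?_
  rw [coeff_macaulayDualGenerator hδ hρd hgraded, MvPolynomial.monomial_mul, mul_one]
  have : (MvPolynomial.monomial (α + γ) (g.coeff α) : MvPolynomial (Fin n) A) =
      g.coeff α • MvPolynomial.monomial (α + γ) 1 := by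
    rw [MvPolynomial.smul_monomial, smul_eq_mul, mul_one]
  rw [this, algebraMap_smul_of_tower, map_smul, smul_eq_mul]

variable (hρ : ((LinearMap.mul A R).compr₂ ρ).IsPerfPair)
  (hsurj : Function.Surjective (algebraMap (MvPolynomial (Fin n) A) R))

-- Vanishing of all coefficients says that `g` pairs to zero with every monomial; monomials span `R`
-- over `A`, so perfectness gives `g = 0` in `R`.
include hρ hsurj hρd hgraded in
theorem contract_macaulayDualGenerator_eq_zero_iff (g : MvPolynomial (Fin n) A) :
    contract g (macaulayDualGenerator δ hδ d ρ) = 0 ↔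
      algebraMap (MvPolynomial (Fin n) A) R g = 0 := by
  constructor
  · intro h
    refine hρ.bijective_left.1 (LinearMap.ext fun r => ?_)
    rw [map_zero, LinearMap.zero_apply]
    obtain ⟨s, rfl⟩ := hsurj r
    change ρ (algebraMap _ R g * algebraMap _ R s) = 0
    induction s using MvPolynomial.induction_on' with
    | monomial γ a =>
      have e : (MvPolynomial.monomial γ a : MvPolynomial (Fin n) A) =
          a • MvPolynomial.monomial γ 1 := by
        rw [MvPolynomial.smul_monomial, smul_eq_mul, mul_one]
      rw [e, algebraMap_smul_of_tower, mul_smul_comm, map_smul,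
        ← coeff_contract_macaulayDualGenerator hδ hρd hgraded, h, MvPolynomial.coeff_zero,
        smul_zero]
    | add p q hp hq => rw [map_add, mul_add, map_add, hp, hq, add_zero]
  · intro h
    ext γ
    rw [coeff_contract_macaulayDualGenerator hδ hρd hgraded, h, zero_mul, map_zero,
      MvPolynomial.coeff_zero]

end Macaulay

/-! ### Frobenius algebras over a field are Gorenstein -/

section Frobenius

variable {k B : Type*} [Field k] [CommRing B] [Algebra k B] [Module.Finite k B]
  {lam : B →ₗ[k] k} (hlam : ∀ b, (∀ y, lam (b * y) = 0) → b = 0)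

include hlam

/-- Every functional is represented by a nondegenerate form. -/
theorem exists_eq_form_mul (φ : B →ₗ[k] k) : ∃ b, ∀ y, φ y = lam (b * y) := by
  let F : B →ₗ[k] Module.Dual k B := (LinearMap.mul k B).compr₂ lam
  have hF : Function.Injective F := by
    rw [injective_iff_map_eq_zero]
    intro b hb
    exact hlam b fun y => LinearMap.congr_fun hb y
  obtain ⟨b, hb⟩ := (LinearMap.injective_iff_surjective_of_finrank_eq_finrank
    (Subspace.dual_finrank_eq (K := k) (V := B)).symm).1 hF φ
  exact ⟨b, fun y => (LinearMap.congr_fun hb y).symm⟩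

/-- Composed with `lam`, a map from an ideal becomes a `k`-linear functional, which extends to `B`
and is represented as `lam (b * ·)`. Nondegeneracy then shows that multiplication by `b` extends the
original map. -/
theorem baer_of_form : Module.Baer B B := by
  intro J g
  obtain ⟨φ, hφ⟩ := LinearMap.exists_extend (p := J.restrictScalars k)
    (lam ∘ₗ (g.restrictScalars k : J.restrictScalars k →ₗ[k] B))
  obtain ⟨b, hb⟩ := exists_eq_form_mul hlam φ
  refine ⟨LinearMap.mulLeft B b, fun x hx => ?_⟩
  rw [LinearMap.mulLeft_apply, ← sub_eq_zero]
  refine hlam _ fun y => ?_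
  have h1 : g (y • ⟨x, hx⟩) = y * g ⟨x, hx⟩ := map_smul g y _
  have h2 : φ (y * x) = lam (g (y • ⟨x, hx⟩)) :=
    LinearMap.congr_fun hφ (⟨y * x, J.mul_mem_left y hx⟩ : J.restrictScalars k)
  rw [hb, h1] at h2
  rw [sub_mul, map_sub, sub_eq_zero, mul_comm (g _) y, ← h2]
  congr 1
  ring

/-- A nondegenerate form induces a nondegenerate form on any localization. -/
theorem exists_form_localization (M : Submonoid B) :
    ∃ mu : Localization M →ₗ[k] k, ∀ b, (∀ y, mu (b * y) = 0) → b = 0 := by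
  have : IsArtinianRing B := IsArtinianRing.of_finite k B
  have hsurj : Function.Surjective (algebraMap B (Localization M)) :=
    IsArtinianRing.localization_surjective M _
  -- The kernel is finitely generated, so the product of elements of `M` killing the generators
  -- kills all of it.
  obtain ⟨s, hsM, hs⟩ : ∃ s ∈ M, ∀ x ∈ RingHom.ker (algebraMap B (Localization M)), s * x = 0 := by
    obtain ⟨G, hG⟩ := IsNoetherian.noetherian (RingHom.ker (algebraMap B (Localization M)))
    have hx : ∀ x : G, ∃ m : M, m * (x : B) = 0 := fun x =>
      (IsLocalization.map_eq_zero_iff M (Localization M) (x : B)).1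
        (hG.le (Submodule.subset_span x.2))
    choose m hm using hx
    refine ⟨∏ x : G, (m x : B), prod_mem fun x _ => (m x).2, fun x hx => ?_⟩
    rw [← hG] at hx
    induction hx using Submodule.span_induction with
    | mem x hx =>
      obtain ⟨c, hc⟩ := Finset.dvd_prod_of_mem (fun x : G => (m x : B))
        (Finset.mem_univ (⟨x, hx⟩ : G))
      rw [hc, mul_right_comm, hm ⟨x, hx⟩, zero_mul]
    | zero => rw [mul_zero]
    | add x y _ _ hx hy => rw [mul_add, hx, hy, add_zero]
    | smul a x _ hx => rw [smul_eq_mul, mul_left_comm, hx, mul_zero]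
  let π : B →ₗ[k] Localization M := (IsScalarTower.toAlgHom k B (Localization M)).toLinearMap
  -- The new form is `y ↦ lam (s * σ y)`. Since `s` kills the kernel of `π`, the product `s * σ y`
  -- equals `s` times any lift of `y`.
  obtain ⟨σ, hσ⟩ := π.exists_rightInverse_of_surjective (LinearMap.range_eq_top.2 hsurj)
  have hmu : ∀ b, s * σ (π b) = s * b := fun b => by
    rw [← sub_eq_zero, ← mul_sub]
    refine hs _ ?_
    rw [RingHom.mem_ker, map_sub, sub_eq_zero]
    exact LinearMap.congr_fun hσ (π b)
  refine ⟨lam ∘ₗ LinearMap.mulLeft k s ∘ₗ σ, fun b hb => ?_⟩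
  obtain ⟨b, rfl⟩ := hsurj b
  have h0 : s * b = 0 := by
    refine hlam _ fun y => ?_
    have h1 : lam (s * σ (π b * π y)) = 0 := hb (π y)
    have h2 : π b * π y = π (b * y) := (map_mul (algebraMap B (Localization M)) b y).symm
    rwa [h2, hmu, ← mul_assoc] at h1
  rw [IsLocalization.map_eq_zero_iff M]
  exact ⟨⟨s, hsM⟩, h0⟩

end Frobenius

/-- A finite algebra over a field with a nondegenerate form is a Gorenstein ring. -/
theorem isGorensteinRing_of_form {k B : Type u} [Field k] [CommRing B] [Algebra k B]
    [Module.Finite k B] {lam : B →ₗ[k] k} (hlam : ∀ b, (∀ y, lam (b * y) = 0) → b = 0) :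
    IsGorensteinRing B where
  noetherian :=
    have : IsArtinianRing B := IsArtinianRing.of_finite k B
    inferInstance
  injDim_ne_top P hP := by
    have : IsArtinianRing B := IsArtinianRing.of_finite k B
    have hsurj : Function.Surjective (algebraMap B (Localization.AtPrime P)) :=
      IsArtinianRing.localization_surjective P.primeCompl _
    have : Module.Finite k (Localization.AtPrime P) := Module.Finite.of_surjective
      (IsScalarTower.toAlgHom k B (Localization.AtPrime P)).toLinearMap hsurj
    obtain ⟨mu, hmu⟩ := exists_form_localization hlam P.primeCompl
    have : Module.Injective (Localization.AtPrime P) (Localization.AtPrime P) :=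
      (baer_of_form hmu).injective
    have : Injective (ModuleCat.of (Localization.AtPrime P) (Localization.AtPrime P)) :=
      Module.injective_object_of_injective_module _ _
    -- An injective object has injective dimension less than `1`, in particular finite.
    have h := (injectiveDimension_lt_iff (n := 1)).2
      (inferInstance : HasInjectiveDimensionLT
        (ModuleCat.of (Localization.AtPrime P) (Localization.AtPrime P)) 1)
    exact (h.trans_le le_top).ne

/-! ### The fibres of `R` over `A`. -/

section Fiber

variable {A R : Type u} [CommRing A] [CommRing R] [Algebra A R] [Module.Finite A R]

open TensorProduct

/-- The identity `r = ∑ ρ (c i * r) • f eᵢ` persists after base change, and it shows that an element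
pairing to zero with every `1 ⊗ c i` is zero. -/
theorem isGorensteinRing_tensorProduct [Module.Projective A R] {ρ : R →ₗ[A] A}
    (hρ : ((LinearMap.mul A R).compr₂ ρ).IsPerfPair) (k : Type u) [Field k] [Algebra A k] :
    IsGorensteinRing (k ⊗[A] R) := by
  obtain ⟨m, f, g, -, -, hfg⟩ := Module.Finite.exists_comp_eq_id_of_projective A R
  choose c hc using fun i => hρ.bijective_left.2 (LinearMap.proj i ∘ₗ g)
  have hr : ∀ r, r = ∑ i, ρ (c i * r) • f (Pi.single i 1) := by
    intro r
    have h : g r = ∑ i, g r i • (Pi.single i 1 : Fin m → A) := by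
      simpa using (pi_eq_sum_univ' (g r))
    have h' : ∀ i, ρ (c i * r) = g r i := fun i => LinearMap.congr_fun (hc i) r
    conv_lhs => rw [← LinearMap.id_apply (R := A) r, ← hfg, LinearMap.comp_apply, h, map_sum]
    simp only [map_smul, h']
  let lam : k ⊗[A] R →ₗ[k] k :=
    (AlgebraTensorModule.rid A k k).toLinearMap ∘ₗ ρ.baseChange k
  have hlam : ∀ a r, lam (a ⊗ₜ r) = ρ r • a := fun a r => by
    simp [lam]
  have hb : ∀ b : k ⊗[A] R, b = ∑ i, lam ((1 ⊗ₜ c i) * b) • (1 ⊗ₜ[A] f (Pi.single i 1)) := by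
    intro b
    induction b using TensorProduct.induction_on with
    | zero => simp
    | tmul a r =>
      conv_lhs => rw [hr r, tmul_sum]
      refine Finset.sum_congr rfl fun i _ => ?_
      rw [Algebra.TensorProduct.tmul_mul_tmul, hlam, one_mul, tmul_smul, smul_tmul', smul_tmul',
        smul_eq_mul, mul_one]
    | add x y hx hy =>
      simp only [mul_add, map_add, add_smul, Finset.sum_add_distrib]
      rw [← hx, ← hy]
  refine isGorensteinRing_of_form (k := k) (lam := lam) fun b h => ?_
  rw [hb b]
  exact Finset.sum_eq_zero fun i _ => by rw [mul_comm, h, zero_smul]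

/-- Lying over for the integral extension `A → R` makes the fibre nonzero, and it is Artinian
because it is finite over a field. -/
theorem ringKrullDim_fiber_eq_zero (hinj : Function.Injective (algebraMap A R))
    (p : PrimeSpectrum A) : ringKrullDim (p.asIdeal.Fiber R) = 0 := by
  have : FaithfulSMul A R := (faithfulSMul_iff_algebraMap_injective A R).2 hinj
  obtain ⟨q, hq⟩ := Algebra.IsIntegral.comap_surjective (R := A) (S := R) p
  have : Nontrivial (p.asIdeal.Fiber R) := PrimeSpectrum.nonempty_iff_nontrivial.1
    ⟨PrimeSpectrum.preimageEquivFiber A R p ⟨q, hq⟩⟩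
  have : IsArtinianRing (p.asIdeal.Fiber R) :=
    IsArtinianRing.of_finite p.asIdeal.ResidueField (p.asIdeal.Fiber R)
  refine le_antisymm ?_ ringKrullDim_nonneg_of_nontrivial
  exact_mod_cast Ring.krullDimLE_iff.1 (inferInstance : Ring.KrullDimLE 0 (p.asIdeal.Fiber R))

end Fiber

end RelGor

end

/-! ### The main theorem. -/

theorem mainTheorem7 {A : Type u} [CommRing A] [IsNoetherianRing A]
    -- the polynomial ring `S = A[x₁,…,xₙ]` with `deg xᵢ = δᵢ > 0`
    (n : ℕ) (δ : Fin n → ℕ) (hδ : ∀ i, 0 < δ i)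
    -- the graded `A`-algebra `R`, nonnegatively graded with `R₀ = A`
    {R : Type u} [CommRing R] [Algebra A R] (𝓡 : ℤ → Submodule A R) [GradedAlgebra 𝓡]
    (hR_neg : ∀ k : ℤ, k < 0 → 𝓡 k = ⊥)
    (hR_zero : Function.Injective (algebraMap A R) ∧ 𝓡 0 = LinearMap.range (Algebra.linearMap A R))
    -- the graded surjection `S → R`, with kernel `I`
    [Algebra (MvPolynomial (Fin n) A) R] [IsScalarTower A (MvPolynomial (Fin n) A) R]
    (hsurj : Function.Surjective (algebraMap (MvPolynomial (Fin n) A) R))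
    (hgraded : ∀ (k : ℤ) (s : MvPolynomial (Fin n) A), s ∈ RelGor.polyGrading A δ k →
      algebraMap (MvPolynomial (Fin n) A) R s ∈ 𝓡 k)
    (I : Ideal (MvPolynomial (Fin n) A))
    (hI : I = RingHom.ker (algebraMap (MvPolynomial (Fin n) A) R))
    -- `R` is finite and flat over `A` and satisfies Poincaré duality
    [Module.Finite A R] [Module.Flat A R]
    (d : ℕ) (hd : 0 < d) (ρ : R →ₗ[A] A)
    (hρ : RelGor.SatisfiesPoincareDuality 𝓡 d ρ) :
    -- (i)
    RelGor.IsArtinianGorensteinOver A R ∧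
    -- (ii) the fibres have dimension `0`, so that `ω_{R/A}` is `Extⁿ_S(R, S(-∑ δᵢ))`, and
    -- `ω_{R/A} ≅ *Hom_A(R, A) ≅ R(d)` as graded modules over `S`, equivalently over `R = S/I`
    (∀ p : PrimeSpectrum A, ringKrullDim (p.asIdeal.Fiber R) = 0) ∧
    (∃ e : Abelian.Ext.{u} (ModuleCat.of (MvPolynomial (Fin n) A) R)
          (ModuleCat.of (MvPolynomial (Fin n) A) (MvPolynomial (Fin n) A)) n
        ≃ₗ[MvPolynomial (Fin n) A]
          RelGor.gradedDual A (MvPolynomial (Fin n) A) (fun k => (𝓡 k).toAddSubgroup),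
      RelGor.IsGradedEquiv
        (RelGor.extGrading (RelGor.polyGrading A δ)
          (M := ModuleCat.of (MvPolynomial (Fin n) A) R)
          (N := ModuleCat.of (MvPolynomial (Fin n) A) (MvPolynomial (Fin n) A))
          (fun k => (𝓡 k).toAddSubgroup)
          (RelGor.shift (RelGor.polyGrading A δ) (-∑ i, (δ i : ℤ))) n)
        (RelGor.gradedDualGrading A (MvPolynomial (Fin n) A) (fun k => (𝓡 k).toAddSubgroup))
        e) ∧
    (∃ e : RelGor.gradedDual A (MvPolynomial (Fin n) A) (fun k => (𝓡 k).toAddSubgroup)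
        ≃ₗ[MvPolynomial (Fin n) A] R,
      RelGor.IsGradedEquiv
        (RelGor.gradedDualGrading A (MvPolynomial (Fin n) A) (fun k => (𝓡 k).toAddSubgroup))
        (fun k => (RelGor.shift (fun k => (𝓡 k).toAddSubgroup) (d : ℤ) k : Set R))
        e) ∧
    -- (iii)
    (I : Set (MvPolynomial (Fin n) A)) =
      {g | RelGor.contract g (RelGor.macaulayDualGenerator δ hδ d ρ) = 0} := by
  have hρp := hρ.perfect
  have : Module.Projective A R :=
    have := Module.finitePresentation_of_finite A R
    Module.Flat.projective_of_finitePresentation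
  have : Module.Projective (MvPolynomial (Fin n) A) (RelGor.EnvPoly n R) :=
    RelGor.EnvPoly.projective hρp
  -- Without variables `R` is concentrated in degree `0`, while `ρ` is supported in degree `d > 0`;
  -- so `ρ = 0`, and perfectness forces `R = 0`.
  have hn : n = 0 → Subsingleton R := by
    rintro rfl
    have h0 : ∀ r, ρ r = 0 := by
      intro r
      obtain ⟨s, rfl⟩ := hsurj r
      refine hρ.graded 0 (by omega) _ (hgraded 0 s (RelGor.EnvPoly.mem_polyGrading.2 fun α _ => ?_))
      rw [Subsingleton.elim α 0, map_zero]
    refine ⟨fun r r' => hρp.bijective_left.1 (LinearMap.ext fun y => ?_)⟩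
    exact (h0 _).trans (h0 _).symm
  refine ⟨⟨⟨inferInstance, fun p => RelGor.isGorensteinRing_tensorProduct hρp _⟩, inferInstance⟩,
    RelGor.ringKrullDim_fiber_eq_zero hR_zero.1,
    ⟨RelGor.extEquiv hρp hn ≪≫ₗ (RelGor.gradedDualEquiv hρp hρ.graded).symm, fun k x => ?_⟩,
    ⟨RelGor.gradedDualEquiv hρp hρ.graded,
      RelGor.mem_gradedDualGrading_iff hρp hρ.graded⟩, ?_⟩
  · rw [RelGor.mem_extGrading_iff_extEquiv_mem hρp hρ.graded hn hgraded k x,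
      RelGor.mem_gradedDualGrading_iff hρp hρ.graded, LinearEquiv.trans_apply,
      LinearEquiv.apply_symm_apply]
  · ext g
    rw [hI, SetLike.mem_coe, RingHom.mem_ker, Set.mem_ofPred_eq]
    exact (RelGor.contract_macaulayDualGenerator_eq_zero_iff hδ hρ.graded hgraded hρp hsurj g).symm
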